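/- **Definitions.** A *triangulation* $T$ (of a square) is a finite oriented simplicial complex homeomorphic to a closed disk with exactly four vertices on its boundary; these are the *corners* $\mathbf p,\mathbf q,\mathbf r,\mathbf s$, labelled in the cyclic order given by the orientation. The other vertices are *interior vertices*. A *drawing* of $T$ is a map $\rho$ from the vertices of $T$ to $\mathbb C^2$ with $\rho(\mathbf p)+\rho(\mathbf r)=\rho(\mathbf q)+\rho(\mathbf s)$. A triangle of $T$ is *nondegenerate* for $\rho$ if $\rho$ maps its vertices to three non-collinear points of $\mathbb C^2$. The *area* of a triangle with vertices $a,b,c$ (in the order given by the orientation of $T$), drawn at $(x_1,y_1),(x_2,y_2),(x_3,y_3)$, is $$\tfrac12\det\begin{pmatrix}1&1&1\\x_1&x_2&x_3\\y_1&y_2&y_3\end{pmatrix}\in\mathbb C .$$ A *subdivision* of $T$ is a set of three vertices that are pairwise joined by edges but are not the vertices of a triangle of $T$; it *contains* a triangle $\Delta$ if $\Delta$ lies inside the corresponding 3-cycle $C$, that is, if after attaching a square $Q$ to $T$ along its boundary (which gives a sphere), $\Delta$ is not in the component of the complement of $C$ that contains the interior of $Q$. An interior (i.e. non-boundary) edge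 $xy$, lying in the triangles $xyz$ and $xyz'$, *can be contracted* if the complex obtained by deleting these two triangles and identifying $x$ with $y$, $zx$ with $zy$ and $z'x$ with $z'y$ is simplicial. A drawing $\rho$ of $T$ is *simple* if (i) every subdivision of $T$ contains at least one nondegenerate triangle of $\rho$; (ii) no interior edge $vw$ with $\rho(v)=\rho(w)$ can be contracted; (iii) every interior vertex belongs to at least one nondegenerate triangle of $\rho$. Drawings $\rho$ of $T$ and $\rho'$ of $T'$ *have the same nondegenerate triangles* if there is a map $f$ from the vertices of $T$ to those of $T'$ that induces a bijection from the nondegenerate triangles of $\rho$ to those of $\rho'$, preserves their orientations, and satisfies $\rho'(f(v))=\rho(v)$ for every vertex $v$ of a nondegenerate triangle of $\rho$. **Theorem.** (a) Let $T$ be a triangulation and let $\rho$ be a drawing of $T$ with $l>0$ nondegenerate triangles. Suppose that no nonempty set of nondegenerate triangles of $\rho$ has areas summing to $0$. Then there are a triangulation $T'$ and a simple drawing $\rho'$ of $T'$ such that $\rho$ and $\rho'$ have the same nondegenerate triangles. (b) Let $T$ be a triangulation and let $\rho$ be a simple drawing of $T$ with $l>0$ nondegenerate triangles. Suppose that no nonempty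 set of nondegenerate triangles of $\rho$ has areas summing to $0$. Then $T$ has at most $\frac32 l-2$ interior vertices and at most $3l-2$ triangles. In particular this holds for every $T'$, $\rho'$ as in (a). -/

import Mathlib

universe u

namespace SquareDrawing

/-! ### Combinatorial disks -/

section Complex

variable {V : Type u} [Fintype V] [DecidableEq V]

/-- The triangles (two-dimensional faces) of a complex. -/
noncomputable def triangles (K : AbstractSimplicialComplex V) : Finset (Finset V) :=
  open Classical in Finset.univ.filter fun t => t ∈ K.faces ∧ t.card = 3

/-- `e` is an edge (one-dimensional face) of the complex. -/
def IsEdge (K : AbstractSimplicialComplex V) (e : Finset V) : Prop :=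
  e ∈ K.faces ∧ e.card = 2

/-- The triangles of the complex that contain a given set of vertices. -/
noncomputable def trianglesAt (K : AbstractSimplicialComplex V) (e : Finset V) :
    Finset (Finset V) :=
  (triangles K).filter fun t => e ⊆ t

/-- A boundary edge is an edge of exactly one triangle. -/
def IsBoundaryEdge (K : AbstractSimplicialComplex V) (e : Finset V) : Prop :=
  IsEdge K e ∧ (trianglesAt K e).card = 1

/-- An interior edge is an edge that is not on the boundary. -/
def IsInteriorEdge (K : AbstractSimplicialComplex V) (e : Finset V) : Prop :=
  IsEdge K e ∧ ¬ IsBoundaryEdge K e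

/-- The graph formed by the vertices and edges of the complex. -/
def oneSkeleton (K : AbstractSimplicialComplex V) : SimpleGraph V where
  Adj a b := a ≠ b ∧ {a, b} ∈ K.faces
  symm := ⟨fun a b h => ⟨h.1.symm, by rw [Finset.pair_comm]; exact h.2⟩⟩
  loopless := ⟨fun _ h => h.1 rfl⟩

/-- The link of the vertex `v` in a two-dimensional complex, as a graph: its vertices are the
neighbours of `v`, and `a`, `b` are joined if `v`, `a`, `b` span a triangle. -/
def linkGraph (K : AbstractSimplicialComplex V) (v : V) :
    SimpleGraph {a : V // (oneSkeleton K).Adj v a} where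
  Adj a b := a ≠ b ∧ {v, a.1, b.1} ∈ K.faces
  symm := ⟨fun a b h => ⟨h.1.symm, by rw [Finset.pair_comm]; exact h.2⟩⟩
  loopless := ⟨fun _ h => h.1 rfl⟩

/-- An edge path: any two consecutive vertices are equal or joined by an edge. -/
def IsEdgePath (K : AbstractSimplicialComplex V) (l : List V) : Prop :=
  l.IsChain fun a b => {a, b} ∈ K.faces

/-- The elementary homotopy of edge paths: a passage `a, b, c` is replaced by `a, c`, where
`a`, `b`, `c` (not necessarily distinct) are the vertices of a face. -/
def ElementaryHomotopy (K : AbstractSimplicialComplex V) (l l' : List V) : Prop :=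
  ∃ (x y : List V) (a b c : V), {a, b, c} ∈ K.faces ∧
    l = x ++ [a, b, c] ++ y ∧ l' = x ++ [a, c] ++ y

/-- `K` is a triangulated closed disk: a connected and simply connected compact surface with
non-empty boundary. The first four fields say that `K` is a surface with boundary: it is purely
two-dimensional, each edge is in at most two triangles, and vertex links are connected (so that
each link is a path or a cycle). Simple connectivity is triviality of the edge-path group. -/
structure IsDisk (K : AbstractSimplicialComplex V) : Prop where
  card_le : ∀ s ∈ K.faces, s.card ≤ 3
  pure : ∀ s ∈ K.faces, ∃ t ∈ triangles K, s ⊆ t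
  edge_card_le : ∀ e, IsEdge K e → (trianglesAt K e).card ≤ 2
  link_connected : ∀ v, (linkGraph K v).Connected
  connected : (oneSkeleton K).Connected
  simply_connected : ∀ (v : V) (l : List V), IsEdgePath K (v :: l ++ [v]) →
    Relation.EqvGen (ElementaryHomotopy K) (v :: l ++ [v]) [v, v]
  boundary_nonempty : ∃ e, IsBoundaryEdge K e

end Complex

/-! ### Triangulations of a square -/

/-- A triangulation of a square with vertex set `V`: an oriented simplicial complex which is a
disk with four vertices on the boundary. The relation `pos a b c` says that `a`, `b`, `c` are the
vertices of a triangle, listed in the cyclic order given by the orientation. The corners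
`𝐩, 𝐪, 𝐫, 𝐬` are `corner 0, corner 1, corner 2, corner 3`. -/
structure Triangulation (V : Type u) [Fintype V] [DecidableEq V] extends
    AbstractSimplicialComplex V where
  isDisk : IsDisk toAbstractSimplicialComplex
  pos : V → V → V → Prop
  /-- Only the vertices of a triangle are ordered, -/
  pos_triangle : ∀ a b c, pos a b c → {a, b, c} ∈ triangles toAbstractSimplicialComplex
  /-- the order is cyclic, -/
  pos_rotate : ∀ a b c, pos a b c → pos b c a
  /-- each triangle has one of its two cyclic orders, -/
  pos_xor : ∀ a b c, {a, b, c} ∈ triangles toAbstractSimplicialComplex →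
    Xor (pos a b c) (pos b a c)
  /-- and two triangles induce opposite directions on a common edge. -/
  pos_coherent : ∀ a b c d, pos a b c → pos a b d → c = d
  corner : Fin 4 → V
  corner_injective : Function.Injective corner
  /-- The boundary is the quadrilateral formed by the corners. -/
  boundary_iff : ∀ e, IsBoundaryEdge toAbstractSimplicialComplex e ↔
    ∃ i, e = {corner i, corner (i + 1)}
  /-- The corners are numbered in the direction that the orientation induces on the boundary. -/
  corner_pos : ∀ i, ∃ c, pos (corner i) (corner (i + 1)) c

namespace Triangulation

variable {V : Type u} [Fintype V] [DecidableEq V]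

/-- The underlying simplicial complex. -/
abbrev cx (T : Triangulation V) : AbstractSimplicialComplex V := T.toAbstractSimplicialComplex

/-- The interior vertices: those that are not corners. -/
noncomputable def interiorVertices (T : Triangulation V) : Finset V :=
  open Classical in Finset.univ.filter fun v => ∀ i, v ≠ T.corner i

/-- A subdivision: three vertices, joined pairwise by edges, that do not span a triangle. -/
def IsSubdivision (T : Triangulation V) (S : Finset V) : Prop :=
  S.card = 3 ∧ (∀ e ⊆ S, e.card = 2 → IsEdge T.cx e) ∧ S ∉ triangles T.cx

/-- Two triangles share an edge which is not an edge of the 3-cycle with vertex set `S`. -/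
def CrossAdj (T : Triangulation V) (S t t' : Finset V) : Prop :=
  t ∈ triangles T.cx ∧ t' ∈ triangles T.cx ∧
    ∃ e, IsEdge T.cx e ∧ e ⊆ t ∧ e ⊆ t' ∧ ¬ e ⊆ S

/-- Attach a square `Q` to `T` along its boundary, which gives a sphere. The triangle `t` is
outside the 3-cycle with vertex set `S` if it lies in the same component of the complement of
the cycle as `Q`: one gets from `t` to `Q` by crossing edges that are not on the cycle. -/
def IsOutside (T : Triangulation V) (S t : Finset V) : Prop :=
  ∃ t', Relation.ReflTransGen (T.CrossAdj S) t t' ∧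
    ∃ e, IsBoundaryEdge T.cx e ∧ e ⊆ t' ∧ ¬ e ⊆ S

/-- The triangle `t` is contained in (lies inside) the 3-cycle with vertex set `S`. -/
def IsInside (T : Triangulation V) (S t : Finset V) : Prop :=
  t ∈ triangles T.cx ∧ ¬ T.IsOutside S t

/-- The identifications of faces made when the edge `xy` is contracted: `x` with `y`, and `zx`
with `zy` for each triangle `xyz`. -/
inductive Identified (T : Triangulation V) (x y : V) : Finset V → Finset V → Prop
  | vertex : Identified T x y {x} {y}
  | edge (z : V) : {x, y, z} ∈ triangles T.cx → Identified T x y {z, x} {z, y}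

/-- The edge `xy` can be contracted. The cells of the contracted complex are the faces of `T`
other than `xy` and the triangles containing it, up to the above identifications; its vertices
are those of `T`, with `y` renamed `x`. This complex is simplicial if different cells have
different vertex sets. -/
def CanContract (T : Triangulation V) (x y : V) : Prop :=
  ∀ s ∈ T.cx.faces, ∀ s' ∈ T.cx.faces, ¬ {x, y} ⊆ s → ¬ {x, y} ⊆ s' →
    s.image (fun v => if v = y then x else v) = s'.image (fun v => if v = y then x else v) →
    s = s' ∨ T.Identified x y s s' ∨ T.Identified x y s' s

end Triangulation

/-! ### Drawings -/

/-- The signed area of an ordered triangle in the complex plane `ℂ²`. -/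
noncomputable def triArea (P Q R : Fin 2 → ℂ) : ℂ :=
  1 / 2 * Matrix.det !![1, 1, 1; P 0, Q 0, R 0; P 1, Q 1, R 1]

/-- A drawing: a map of the vertices to `ℂ²` that sends the corners to the vertices of a
(possibly degenerate) parallelogram. -/
structure Drawing {V : Type u} [Fintype V] [DecidableEq V] (T : Triangulation V) where
  toFun : V → Fin 2 → ℂ
  parallelogram : toFun (T.corner 0) + toFun (T.corner 2) =
    toFun (T.corner 1) + toFun (T.corner 3)

namespace Drawing

variable {V : Type u} [Fintype V] [DecidableEq V] {T : Triangulation V}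

/-- The nondegenerate triangles: those whose vertices are drawn at non-collinear points. -/
noncomputable def nondegenerate (ρ : Drawing T) : Finset (Finset V) :=
  open Classical in
    (triangles T.cx).filter fun t => ¬ Collinear ℂ (ρ.toFun '' (t : Set V))

/-- The area of a triangle of `T` in the drawing, its vertices being ordered according to the
orientation of `T` (by `area_eq` below, the choice of the first vertex does not matter). -/
noncomputable def area (ρ : Drawing T) (t : Finset V) : ℂ :=
  open Classical in
    if h : ∃ x : V × V × V, T.pos x.1 x.2.1 x.2.2 ∧ t = {x.1, x.2.1, x.2.2} then
      triArea (ρ.toFun h.choose.1) (ρ.toFun h.choose.2.1) (ρ.toFun h.choose.2.2)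
    else 0

/-- No non-empty set of nondegenerate triangles has areas summing to zero. -/
def NoZeroSum (ρ : Drawing T) : Prop :=
  ∀ S ⊆ ρ.nondegenerate, S.Nonempty → ∑ t ∈ S, ρ.area t ≠ 0

/-- A simple drawing. An edge `vw` is elastic if `v` and `w` are drawn at the same point. -/
structure IsSimple (ρ : Drawing T) : Prop where
  subdivision : ∀ S, T.IsSubdivision S → ∃ t ∈ ρ.nondegenerate, T.IsInside S t
  elastic : ¬ ∃ v w, IsInteriorEdge T.cx {v, w} ∧ ρ.toFun v = ρ.toFun w ∧ T.CanContract v w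
  interior : ∀ v ∈ T.interiorVertices, ∃ t ∈ ρ.nondegenerate, v ∈ t

/-- The drawings `ρ` and `ρ'` (of possibly different triangulations) have the same nondegenerate
triangles: a map `f` of vertices matches them bijectively, and matched triangles have the same
vertices in `ℂ²` and the same orientation. -/
def SameNondegenerate {V' : Type u} [Fintype V'] [DecidableEq V'] {T' : Triangulation V'}
    (ρ : Drawing T) (ρ' : Drawing T') : Prop :=
  ∃ f : V → V',
    Set.BijOn (fun t => t.image f) (ρ.nondegenerate : Set (Finset V))
      (ρ'.nondegenerate : Set (Finset V')) ∧
    (∀ t ∈ ρ.nondegenerate, ∀ v ∈ t, ρ'.toFun (f v) = ρ.toFun v) ∧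
    ∀ a b c, T.pos a b c → {a, b, c} ∈ ρ.nondegenerate → T'.pos (f a) (f b) (f c)

theorem triArea_rotate (P Q R : Fin 2 → ℂ) : triArea Q R P = triArea P Q R := by
  simp [triArea, Matrix.det_fin_three]
  ring

theorem area_eq (ρ : Drawing T) {a b c : V} (h : T.pos a b c) :
    ρ.area {a, b, c} = triArea (ρ.toFun a) (ρ.toFun b) (ρ.toFun c) := by
  have hex : ∃ x : V × V × V, T.pos x.1 x.2.1 x.2.2 ∧
      ({a, b, c} : Finset V) = {x.1, x.2.1, x.2.2} := ⟨(a, b, c), h, rfl⟩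
  have hne : ∀ x y z, T.pos x y z → ¬ T.pos y x z := fun x y z h1 h2 => by
    rcases T.pos_xor _ _ _ (T.pos_triangle _ _ _ h1) with h3 | h3
    · exact h3.2 h2
    · exact h3.2 h1
  have hd : ∀ x y z, T.pos x y z → x ≠ y := fun x y z h1 h2 => by
    subst h2
    exact hne _ _ _ h1 h1
  rw [area, dif_pos hex]
  obtain ⟨hp, he⟩ := hex.choose_spec
  generalize hex.choose = w at hp he
  obtain ⟨x, y, z⟩ := w
  change T.pos x y z at hp
  change triArea (ρ.toFun x) (ρ.toFun y) (ρ.toFun z) = _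
  have hx : x ∈ ({a, b, c} : Finset V) := by rw [he]; simp
  have hy : y ∈ ({a, b, c} : Finset V) := by rw [he]; simp
  have hz : z ∈ ({a, b, c} : Finset V) := by rw [he]; simp
  clear he hex
  have hp1 := T.pos_rotate _ _ _ hp
  have hp2 := T.pos_rotate _ _ _ hp1
  have h1 := hd _ _ _ hp
  have h2 := hd _ _ _ hp1
  have h3 := hd _ _ _ hp2
  have n0 := hne _ _ _ h
  simp only [Finset.mem_insert, Finset.mem_singleton] at hx hy hz
  rcases hx with hx | hx | hx <;> rcases hy with hy | hy | hy <;>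
    rcases hz with hz | hz | hz <;> rw [hx, hy] at h1 <;> rw [hy, hz] at h2 <;>
    rw [hz, hx] at h3 <;> rw [hx, hy, hz] at hp hp1 hp2 ⊢ <;>
    first
    | exact absurd rfl h1
    | exact absurd rfl h2
    | exact absurd rfl h3
    | exact absurd hp n0
    | exact absurd hp1 n0
    | exact absurd hp2 n0
    | exact triArea_rotate _ _ _
    | exact (triArea_rotate _ _ _).symm

end Drawing

end SquareDrawing

/-! Call an edge elastic if both its ends are drawn at the same point. The area of a triangle is a
sum of terms over its directed edges, so a region of triangles has an area that depends only on how
its boundary is drawn. If that area is zero, the hypothesis on sums forces every triangle of the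
region to be degenerate. Two cases matter. The parallelogram of the corners is nondegenerate
(`NoZeroSum.cross_corner_ne_zero`), and a 3-cycle with an elastic edge has only degenerate triangles
inside (`NoZeroSum.not_isInside`).

Part (b). An edge that cannot be contracted lies on a 3-cycle that bounds no triangle
(`exists_subdivision`). Together with the two facts above, this shows that a simple drawing has no
elastic edge (`IsSimple.toFun_ne`). Hence a fan of degenerate triangles around a vertex v has all
its vertices on one line through v. So an interior vertex cannot lie in exactly one nondegenerate
triangle, and a corner cannot lie in none. With n interior vertices, counting incidences gives 3l ≥
2n + 4, and Euler's formula gives 2n + 2 triangles.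

Part (a). The proof is by induction on the number of vertices, since contracting an elastic edge
removes a vertex and keeps the nondegenerate triangles. An interior vertex in degenerate triangles
only can be moved onto a neighbour, which creates an elastic edge (`exists_redraw`). If this edge
cannot be contracted, it lies on a 3-cycle with no nondegenerate triangle inside. If a 3-cycle has
no nondegenerate triangle inside, a vertex strictly inside it can be moved in this way. Either the
new elastic edge is contracted, or it lies on a 3-cycle with fewer triangles inside
(`NoZeroSum.isReducible_of_subdivision`).

The topology is done modulo two. Triviality of the edge-path group makes every 1-cocycle a
coboundary, and nonempty boundary with strong connectivity excludes 2-cycles. This yields Euler's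
formula and the Jordan curve theorem for 3-cycles (`sum_insideChain`). The remaining work is to
check that a contracted disk is again a disk. -/

namespace SquareDrawing

/-! ### Oriented triangulations -/

section Faces

variable {V : Type u}

theorem face_mono (K : AbstractSimplicialComplex V) {s t : Finset V} (ht : t ∈ K.faces)
    (hs : s ⊆ t) (hn : s.Nonempty) : s ∈ K.faces :=
  (K.isRelLowerSet_faces ht).2 hs hn

variable [Fintype V]

theorem mem_triangles {K : AbstractSimplicialComplex V} {t : Finset V} :
    t ∈ triangles K ↔ t ∈ K.faces ∧ t.card = 3 := by
  simp [triangles]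

theorem isEdge_of_subset {K : AbstractSimplicialComplex V} {e t : Finset V}
    (ht : t ∈ triangles K) (he : e ⊆ t) (hc : e.card = 2) : IsEdge K e :=
  ⟨face_mono K (mem_triangles.1 ht).1 he (Finset.card_pos.1 (by omega)), hc⟩

variable [DecidableEq V]

theorem mem_trianglesAt {K : AbstractSimplicialComplex V} {e t : Finset V} :
    t ∈ trianglesAt K e ↔ t ∈ triangles K ∧ e ⊆ t := by
  simp [trianglesAt]

end Faces

/-! ### Darts, links and strong connectedness -/

namespace Triangulation

variable {V : Type u} [Fintype V] [DecidableEq V] (T : Triangulation V)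

/-- `a, b` is a directed edge of the oriented boundary of some triangle. -/
def IsDart (a b : V) : Prop := ∃ c, T.pos a b c

variable {T}

theorem pos_asymm {a b c : V} (h : T.pos a b c) : ¬ T.pos b a c := fun h' => by
  rcases T.pos_xor _ _ _ (T.pos_triangle _ _ _ h) with h3 | h3
  · exact h3.2 h'
  · exact h3.2 h

theorem pos_ne {a b c : V} (h : T.pos a b c) : a ≠ b := fun e => by
  subst e
  exact pos_asymm h h

theorem pos_ne₂ {a b c : V} (h : T.pos a b c) : b ≠ c := pos_ne (T.pos_rotate _ _ _ h)

theorem pos_ne₃ {a b c : V} (h : T.pos a b c) : c ≠ a :=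
  pos_ne (T.pos_rotate _ _ _ (T.pos_rotate _ _ _ h))

theorem pos_rotate' {a b c : V} (h : T.pos a b c) : T.pos c a b :=
  T.pos_rotate _ _ _ (T.pos_rotate _ _ _ h)

theorem exists_pos {t : Finset V} (ht : t ∈ triangles T.cx) :
    ∃ a b c, T.pos a b c ∧ t = {a, b, c} := by
  obtain ⟨a, b, c, -, -, -, rfl⟩ := Finset.card_eq_three.1 (mem_triangles.1 ht).2
  rcases T.pos_xor _ _ _ ht with h | h
  · exact ⟨a, b, c, h.1, rfl⟩
  · exact ⟨b, a, c, h.1, Finset.insert_comm _ _ _⟩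

theorem exists_pos_of_mem {t : Finset V} (ht : t ∈ triangles T.cx) {a : V} (ha : a ∈ t) :
    ∃ b c, T.pos a b c ∧ t = {a, b, c} := by
  obtain ⟨x, y, z, h, rfl⟩ := exists_pos ht
  simp only [Finset.mem_insert, Finset.mem_singleton] at ha
  rcases ha with rfl | rfl | rfl
  · exact ⟨y, z, h, rfl⟩
  · exact ⟨z, x, T.pos_rotate _ _ _ h, by grind⟩
  · exact ⟨x, y, pos_rotate' h, by grind⟩

theorem exists_pos_of_pair {t : Finset V} (ht : t ∈ triangles T.cx) {a b : V} (hab : a ≠ b)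
    (ha : a ∈ t) (hb : b ∈ t) :
    ∃ c, (T.pos a b c ∨ T.pos b a c) ∧ t = {a, b, c} := by
  obtain ⟨y, z, h, rfl⟩ := exists_pos_of_mem ht ha
  simp only [Finset.mem_insert, Finset.mem_singleton] at hb
  rcases hb with rfl | rfl | rfl
  · exact absurd rfl hab
  · exact ⟨z, Or.inl h, rfl⟩
  · exact ⟨y, Or.inr (pos_rotate' h), by grind⟩

theorem pos_or {a b c : V} (h : {a, b, c} ∈ triangles T.cx) : T.pos a b c ∨ T.pos b a c := by
  rcases T.pos_xor _ _ _ h with h | h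
  · exact Or.inl h.1
  · exact Or.inr h.1

theorem pos_adj {a b c : V} (h : T.pos a b c) : (oneSkeleton T.cx).Adj a b :=
  ⟨pos_ne h, face_mono _ (mem_triangles.1 (T.pos_triangle _ _ _ h)).1 (by grind) (by simp)⟩

theorem pos_adj₃ {a b c : V} (h : T.pos a b c) : (oneSkeleton T.cx).Adj a c :=
  (pos_adj (pos_rotate' h)).symm

theorem IsDart.adj {a b : V} (h : T.IsDart a b) : (oneSkeleton T.cx).Adj a b :=
  pos_adj h.choose_spec

theorem adj_iff {a b : V} : (oneSkeleton T.cx).Adj a b ↔ T.IsDart a b ∨ T.IsDart b a := by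
  refine ⟨fun h => ?_, fun h => h.elim IsDart.adj fun h => h.adj.symm⟩
  obtain ⟨t, ht, hs⟩ := T.isDisk.pure _ h.2
  obtain ⟨c, hc | hc, -⟩ := exists_pos_of_pair ht h.1 (hs (by simp)) (hs (by simp))
  · exact Or.inl ⟨c, hc⟩
  · exact Or.inr ⟨c, hc⟩

theorem adj_isEdge {a b : V} (h : (oneSkeleton T.cx).Adj a b) : IsEdge T.cx {a, b} :=
  ⟨h.2, Finset.card_pair h.1⟩

theorem isEdge_adj {a b : V} (h : IsEdge T.cx {a, b}) : (oneSkeleton T.cx).Adj a b := by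
  refine ⟨fun e => ?_, h.1⟩
  have := h.2
  subst e
  simp at this

/-- By coherence each direction of an edge belongs to at most one triangle, so an edge traversed in
a single direction lies in a single triangle. -/
theorem isBoundaryEdge_of_dart {a b : V} (h : T.IsDart a b) (h' : ¬ T.IsDart b a) :
    IsBoundaryEdge T.cx {a, b} := by
  obtain ⟨c, hc⟩ := h
  refine ⟨adj_isEdge (pos_adj hc), Finset.card_eq_one.2 ⟨{a, b, c}, ?_⟩⟩
  ext t
  rw [mem_trianglesAt, Finset.mem_singleton]
  constructor
  · rintro ⟨ht, hs⟩
    obtain ⟨d, hd | hd, rfl⟩ := exists_pos_of_pair ht (pos_ne hc) (hs (by simp)) (hs (by simp))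
    · rw [T.pos_coherent _ _ _ _ hc hd]
    · exact absurd ⟨d, hd⟩ h'
  · rintro rfl
    exact ⟨T.pos_triangle _ _ _ hc, by grind⟩

theorem not_isBoundaryEdge_of_darts {a b : V} (h : T.IsDart a b) (h' : T.IsDart b a) :
    ¬ IsBoundaryEdge T.cx {a, b} := by
  rintro ⟨-, hb⟩
  obtain ⟨c, hc⟩ := h
  obtain ⟨d, hd⟩ := h'
  have hcd : c ≠ d := fun e => pos_asymm hc (e ▸ hd)
  have h1 : {a, b, c} ∈ trianglesAt T.cx {a, b} :=
    mem_trianglesAt.2 ⟨T.pos_triangle _ _ _ hc, by grind⟩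
  have h2 : {b, a, d} ∈ trianglesAt T.cx {a, b} :=
    mem_trianglesAt.2 ⟨T.pos_triangle _ _ _ hd, by grind⟩
  have h3 := Finset.card_le_one.1 hb.le _ h1 _ h2
  have h4 : c ∈ ({b, a, d} : Finset V) := h3 ▸ by simp
  have := pos_ne₂ hc
  have := pos_ne₃ hc
  grind

theorem isDart_corner (i : Fin 4) : T.IsDart (T.corner i) (T.corner (i + 1)) := T.corner_pos i

theorem not_isDart_corner (i : Fin 4) : ¬ T.IsDart (T.corner (i + 1)) (T.corner i) := fun h =>
  not_isBoundaryEdge_of_darts (isDart_corner i) h ((T.boundary_iff _).2 ⟨i, rfl⟩)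

theorem exists_corner_of_dart {a b : V} (h : T.IsDart a b) (h' : ¬ T.IsDart b a) :
    ∃ i, a = T.corner i ∧ b = T.corner (i + 1) := by
  obtain ⟨i, hi⟩ := (T.boundary_iff _).1 (isBoundaryEdge_of_dart h h')
  have hne := h.adj.1
  have ha : a ∈ ({T.corner i, T.corner (i + 1)} : Finset V) := hi ▸ by simp
  have hb : b ∈ ({T.corner i, T.corner (i + 1)} : Finset V) := hi ▸ by simp
  simp only [Finset.mem_insert, Finset.mem_singleton] at ha hb
  rcases ha with ha | ha <;> rcases hb with hb | hb
  · exact absurd (ha.trans hb.symm) hne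
  · exact ⟨i, ha, hb⟩
  · subst ha hb
    exact absurd (isDart_corner i) h'
  · exact absurd (ha.trans hb.symm) hne

theorem IsDart.symm_of_interior {a b : V} (h : T.IsDart a b) (ha : ∀ i, a ≠ T.corner i) :
    T.IsDart b a := by
  by_contra h'
  obtain ⟨i, hi, -⟩ := exists_corner_of_dart h h'
  exact ha i hi

theorem IsDart.symm_of_interior' {a b : V} (h : T.IsDart b a) (ha : ∀ i, a ≠ T.corner i) :
    T.IsDart a b := by
  by_contra h'
  obtain ⟨i, -, hi⟩ := exists_corner_of_dart h h'
  exact ha _ hi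

theorem isDart_of_interior {a b : V} (h : (oneSkeleton T.cx).Adj a b)
    (ha : ∀ i, a ≠ T.corner i) : T.IsDart a b :=
  (adj_iff.1 h).elim id fun h => h.symm_of_interior' ha

theorem isInteriorEdge_iff {a b : V} :
    IsInteriorEdge T.cx {a, b} ↔ T.IsDart a b ∧ T.IsDart b a := by
  constructor
  · rintro ⟨h1, h2⟩
    rcases adj_iff.1 (isEdge_adj h1) with h | h
    · refine ⟨h, by_contra fun h' => h2 (isBoundaryEdge_of_dart h h')⟩
    · refine ⟨by_contra fun h' => h2 ?_, h⟩
      rw [Finset.pair_comm]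
      exact isBoundaryEdge_of_dart h h'
  · rintro ⟨h1, h2⟩
    exact ⟨adj_isEdge h1.adj, not_isBoundaryEdge_of_darts h1 h2⟩

theorem exists_adj (v : V) : ∃ a, (oneSkeleton T.cx).Adj v a :=
  let ⟨a⟩ := (T.isDisk.link_connected v).nonempty
  ⟨a.1, a.2⟩

/-- The link of a vertex is connected. -/
theorem link_induction {v : V} {P : V → Prop} {a₀ : V} (h₀ : (oneSkeleton T.cx).Adj v a₀)
    (hP : P a₀) (step : ∀ a b, T.pos v a b → (P a ↔ P b)) {a : V}
    (ha : (oneSkeleton T.cx).Adj v a) : P a := by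
  obtain ⟨w⟩ := (T.isDisk.link_connected v).preconnected ⟨a₀, h₀⟩ ⟨a, ha⟩
  suffices h : ∀ x y : {a : V // (oneSkeleton T.cx).Adj v a}, (linkGraph T.cx v).Walk x y →
      P x.1 → P y.1 from h _ _ w hP
  intro x y w
  induction w with
  | nil => exact id
  | @cons x y z hxy _ ih =>
    refine fun hx => ih ?_
    have hne : x.1 ≠ y.1 := fun e => hxy.1 (Subtype.ext e)
    have ht : {x.1, v, y.1} ∈ triangles T.cx := by
      rw [Finset.insert_comm]
      exact mem_triangles.2 ⟨hxy.2, Finset.card_eq_three.2 ⟨_, _, _, x.2.1, y.2.1, hne, rfl⟩⟩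
    rcases pos_or ht with h | h
    · exact (step _ _ (T.pos_rotate _ _ _ h)).2 hx
    · exact (step _ _ h).1 hx

theorem pos_coherent_left {v a a' c : V} (h : T.pos v a c) (h' : T.pos v a' c) : a = a' :=
  T.pos_coherent _ _ _ _ (pos_rotate' h) (pos_rotate' h')

/-- The link of an interior vertex is a directed cycle. -/
theorem cyclic_link_induction {v : V} (hv : ∀ i, v ≠ T.corner i) {P : V → Prop} {a₀ : V}
    (h₀ : (oneSkeleton T.cx).Adj v a₀) (hP : P a₀)
    (step : ∀ a b, T.pos v a b → P a → P b) {a : V}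
    (ha : (oneSkeleton T.cx).Adj v a) : P a := by
  classical
  have hs : ∀ a : {a // (oneSkeleton T.cx).Adj v a ∧ P a}, ∃ b, T.pos v a.1 b := fun a =>
    isDart_of_interior a.2.1 hv
  choose s hs using hs
  -- The successor map around the link is injective on the finite set of neighbours satisfying `P`,
  -- hence surjective there. So `P` also passes backwards, and the two-sided `link_induction`
  -- applies.
  let σ : {a // (oneSkeleton T.cx).Adj v a ∧ P a} → {a // (oneSkeleton T.cx).Adj v a ∧ P a} :=
    fun a => ⟨s a, pos_adj₃ (hs a), step _ _ (hs a) a.2.2⟩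
  have hinj : Function.Injective σ := fun a b hab => by
    have hab : s a = s b := congrArg Subtype.val hab
    exact Subtype.ext (pos_coherent_left (hs a) (hab ▸ hs b))
  have hsurj := Finite.surjective_of_injective hinj
  refine link_induction h₀ hP (fun a b h => ⟨step a b h, fun hb => ?_⟩) ha
  obtain ⟨c, hc⟩ := hsurj ⟨b, pos_adj₃ h, hb⟩
  have hc : s c = b := congrArg Subtype.val hc
  have := pos_coherent_left h (hc ▸ hs c)
  exact this ▸ c.2.2

theorem connected_induction {P : V → Prop} {a₀ : V} (h₀ : P a₀)
    (step : ∀ a b, (oneSkeleton T.cx).Adj a b → P a → P b) (a : V) : P a := by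
  obtain ⟨w⟩ := T.isDisk.connected.preconnected a₀ a
  induction w with
  | nil => exact h₀
  | cons h _ ih => exact ih (step _ _ h h₀)

/-- A property of the triangles at `v` spreads over them through the edges at `v`. -/
theorem star_induction {v : V} {P : Finset V → Prop} {t₀ : Finset V}
    (ht₀ : t₀ ∈ triangles T.cx) (hv₀ : v ∈ t₀) (hP : P t₀)
    (step : ∀ t t' a, t ∈ triangles T.cx → t' ∈ triangles T.cx → a ≠ v → {v, a} ⊆ t →
      {v, a} ⊆ t' → P t → P t') {t : Finset V} (ht : t ∈ triangles T.cx) (hv : v ∈ t) : P t := by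
  obtain ⟨b₀, c₀, h₀, rfl⟩ := exists_pos_of_mem ht₀ hv₀
  obtain ⟨b, c, h, rfl⟩ := exists_pos_of_mem ht hv
  have key : ∀ t ∈ triangles T.cx, {v, b} ⊆ t → P t := by
    refine link_induction (P := fun b => ∀ t ∈ triangles T.cx, {v, b} ⊆ t → P t)
      (pos_adj h₀) (fun t ht hs => step _ _ b₀ ht₀ ht (pos_ne h₀).symm (by grind) hs hP) ?_
      (pos_adj h)
    intro x y hxy
    have htr := T.pos_triangle _ _ _ hxy
    exact ⟨fun H t ht hs => step _ _ y htr ht (pos_ne₃ hxy) (by grind) hs (H _ htr (by grind)),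
      fun H t ht hs => step _ _ x htr ht (pos_ne hxy).symm (by grind) hs (H _ htr (by grind))⟩
  exact key _ ht (by grind)

/-- The triangulation is strongly connected. -/
theorem triangle_induction {P : Finset V → Prop} {t₀ : Finset V}
    (ht₀ : t₀ ∈ triangles T.cx) (hP : P t₀)
    (step : ∀ t t' e, t ∈ triangles T.cx → t' ∈ triangles T.cx → IsEdge T.cx e → e ⊆ t →
      e ⊆ t' → P t → P t') {t : Finset V} (ht : t ∈ triangles T.cx) : P t := by
  have hstar : ∀ v t₀, t₀ ∈ triangles T.cx → v ∈ t₀ → P t₀ →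
      ∀ t ∈ triangles T.cx, v ∈ t → P t := fun v t₀ ht₀ hv₀ hP t ht hv =>
    star_induction ht₀ hv₀ hP (fun t t' a h h' ha hs hs' => step t t' {v, a} h h'
      (isEdge_of_subset h hs (Finset.card_pair ha.symm)) hs hs') ht hv
  obtain ⟨a₀, b₀, c₀, h₀, rfl⟩ := exists_pos ht₀
  obtain ⟨a, b, c, h, rfl⟩ := exists_pos ht
  refine connected_induction (T := T) (P := fun v => ∀ t ∈ triangles T.cx, v ∈ t → P t)
    (hstar a₀ _ ht₀ (by simp) hP) (fun x y hxy H => ?_) a _ ht (by simp)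
  obtain ⟨t, ht, hs⟩ := T.isDisk.pure _ hxy.2
  exact hstar y t ht (hs (by simp)) (H _ ht (hs (by simp)))

/-- A disk contains no closed surface. -/
theorem no_closed_surface {I : Set (Finset V)} (hI : I ⊆ triangles T.cx) (hne : I.Nonempty)
    (h : ∀ t ∈ I, ∀ e ⊆ t, e.card = 2 → ∃ t' ∈ I, t' ≠ t ∧ e ⊆ t') : False := by
  obtain ⟨t₀, ht₀⟩ := hne
  -- An edge of a triangle of `I` already has two triangles in `I`, so it has no third one. Thus `I`
  -- is closed under adjacency and contains every triangle, including the one at a boundary edge.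
  have hall : ∀ t ∈ triangles T.cx, t ∈ I := fun t ht => by
    refine triangle_induction (P := (· ∈ I)) (hI ht₀) ht₀ ?_ ht
    intro t t' e ht ht' he hs hs' hP
    obtain ⟨t'', h1, h2, h3⟩ := h t hP e hs he.2
    by_contra hn
    have : ({t, t', t''} : Finset _).card ≤ 2 :=
      (Finset.card_le_card (by
        intro s
        simp only [Finset.mem_insert, Finset.mem_singleton]
        rintro (rfl | rfl | rfl)
        · exact mem_trianglesAt.2 ⟨ht, hs⟩
        · exact mem_trianglesAt.2 ⟨ht', hs'⟩
        · exact mem_trianglesAt.2 ⟨hI h1, h3⟩)).trans (T.isDisk.edge_card_le e he)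
    rw [Finset.card_eq_three.2 ⟨t, t', t'', fun e => hn (e ▸ hP), h2.symm,
      fun e => hn (e ▸ h1), rfl⟩] at this
    omega
  obtain ⟨e, he, hc⟩ := T.isDisk.boundary_nonempty
  obtain ⟨t, ht⟩ := Finset.card_eq_one.1 hc
  have ht' : t ∈ trianglesAt T.cx e := by rw [ht]; simp
  rw [mem_trianglesAt] at ht'
  obtain ⟨t', h1, h2, h3⟩ := h t (hall t ht'.1) e ht'.2 he.2
  have : t' ∈ trianglesAt T.cx e := mem_trianglesAt.2 ⟨hI h1, h3⟩
  rw [ht, Finset.mem_singleton] at this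
  exact h2 this

end Triangulation

/-! ### Homology modulo two -/

section Edges

variable {V : Type u} [Fintype V]

/-- The finite set of edges of a complex. -/
noncomputable def edges (K : AbstractSimplicialComplex V) : Finset (Finset V) :=
  open Classical in Finset.univ.filter fun e => IsEdge K e

theorem mem_edges {K : AbstractSimplicialComplex V} {e : Finset V} :
    e ∈ edges K ↔ IsEdge K e := by
  simp [edges]

variable [DecidableEq V]

/-- The incidences modulo two of edges and triangles. -/
noncomputable def edgeTriangle (K : AbstractSimplicialComplex V) :
    Matrix (edges K) (triangles K) (ZMod 2) :=
  fun e t => if e.1 ⊆ t.1 then 1 else 0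

/-- The incidences modulo two of edges and vertices. -/
noncomputable def edgeVertex (K : AbstractSimplicialComplex V) : Matrix (edges K) V (ZMod 2) :=
  fun e v => if v ∈ e.1 then 1 else 0

/-- The edges of the complex spanned by the vertex set `S`, as a chain modulo two. -/
noncomputable def edgeChain (K : AbstractSimplicialComplex V) (S : Finset V) :
    edges K → ZMod 2 :=
  fun e => if e.1 ⊆ S then 1 else 0

/-- The boundary of a 3-cycle of edges vanishes. -/
theorem edgeChain_vecMul {K : AbstractSimplicialComplex V} {S : Finset V} (hS : S.card = 3)
    (hE : ∀ e ⊆ S, e.card = 2 → IsEdge K e) :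
    Matrix.vecMul (edgeChain K S) (edgeVertex K) = 0 := by
  ext v
  have h1 : Matrix.vecMul (edgeChain K S) (edgeVertex K) v =
      (((edges K).filter fun e => e ⊆ S ∧ v ∈ e).card : ZMod 2) := by
    simp only [Matrix.vecMul, dotProduct, edgeChain, edgeVertex]
    rw [Finset.sum_coe_sort (edges K)
      (fun e => (if e ⊆ S then 1 else 0) * if v ∈ e then (1 : ZMod 2) else 0)]
    simp only [mul_ite, mul_one, mul_zero, ← ite_and, Finset.sum_boole, and_comm]
  rw [h1, Pi.zero_apply]
  by_cases hv : v ∈ S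
  · obtain ⟨a, b, hab, hSv⟩ := Finset.card_eq_two.1
      (show (S.erase v).card = 2 by rw [Finset.card_erase_of_mem hv, hS])
    have ha : a ∈ S.erase v := by simp [hSv]
    have hb : b ∈ S.erase v := by simp [hSv]
    rw [Finset.mem_erase] at ha hb
    have h2 : ((edges K).filter fun e => e ⊆ S ∧ v ∈ e) = {{v, a}, {v, b}} := by
      ext e
      simp only [Finset.mem_filter, mem_edges, Finset.mem_insert, Finset.mem_singleton]
      constructor
      · rintro ⟨he, hs, hve⟩
        obtain ⟨w, hw⟩ := Finset.card_eq_one.1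
          (show (e.erase v).card = 1 by rw [Finset.card_erase_of_mem hve, he.2])
        have hwS : w ∈ S.erase v := by
          have : w ∈ e.erase v := by simp [hw]
          rw [Finset.mem_erase] at this ⊢
          exact ⟨this.1, hs this.2⟩
        rw [hSv, Finset.mem_insert, Finset.mem_singleton] at hwS
        rw [← Finset.insert_erase hve, hw]
        rcases hwS with rfl | rfl
        · exact Or.inl rfl
        · exact Or.inr rfl
      · have h3 : ∀ w, w ≠ v ∧ w ∈ S → IsEdge K {v, w} ∧ {v, w} ⊆ S ∧ v ∈ ({v, w} : Finset V) :=
          fun w hw => by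
            have hs : {v, w} ⊆ S := by grind
            exact ⟨hE _ hs (Finset.card_pair hw.1.symm), hs, by simp⟩
        rintro (rfl | rfl)
        · exact h3 a ha
        · exact h3 b hb
    rw [h2, Finset.card_pair (by grind)]
    rfl
  · rw [Finset.filter_false_of_mem]
    · simp
    · rintro e - ⟨hs, hve⟩
      exact hv (hs hve)

/-- The boundary of a boundary vanishes: column `t` of `edgeTriangle` is the edge chain of the
3-cycle around `t`. -/
theorem edgeTriangle_transpose_mul (K : AbstractSimplicialComplex V) :
    (edgeTriangle K).transpose * edgeVertex K = 0 := by
  ext t v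
  have h := edgeChain_vecMul (mem_triangles.1 t.2).2
    (fun e he hc => isEdge_of_subset t.2 he hc)
  exact congrFun h v

/-- The value of a cochain on the directed edge from `a` to `b`. -/
noncomputable def dartValue {K : AbstractSimplicialComplex V} (h : edges K → ZMod 2) (a b : V) :
    ZMod 2 :=
  if h' : {a, b} ∈ edges K then h ⟨_, h'⟩ else 0

/-- The sum of a cochain along an edge path. -/
noncomputable def pathSum {K : AbstractSimplicialComplex V} (h : edges K → ZMod 2) :
    List V → ZMod 2
  | [] => 0
  | [_] => 0
  | a :: b :: l => dartValue h a b + pathSum h (b :: l)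

variable {K : AbstractSimplicialComplex V} (h : edges K → ZMod 2)

theorem dartValue_self (a : V) : dartValue h a a = 0 := by
  rw [dartValue, dif_neg]
  intro h'
  have := (mem_edges.1 h').2
  simp at this

theorem dartValue_comm (a b : V) : dartValue h a b = dartValue h b a := by
  simp only [dartValue, Finset.pair_comm a b]

theorem pathSum_append (l l' : List V) (a : V) :
    pathSum h (l ++ a :: l') = pathSum h (l ++ [a]) + pathSum h (a :: l') := by
  induction l with
  | nil => simp [pathSum]
  | cons b l ih =>
    cases l with
    | nil => simp [pathSum]
    | cons c l =>
      simp only [List.cons_append, pathSum] at ih ⊢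
      rw [ih, add_assoc]

theorem pathSum_reverse (l : List V) : pathSum h l.reverse = pathSum h l := by
  induction l with
  | nil => rfl
  | cons a l ih =>
    cases l with
    | nil => rfl
    | cons b l =>
      rw [List.reverse_cons, List.reverse_cons, List.append_assoc, List.singleton_append,
        pathSum_append, ← List.reverse_cons, ih]
      simp only [pathSum]
      rw [dartValue_comm]
      ring

variable {h}

/-- The cocycle condition, including faces with repeated vertices, which elementary homotopies
allow: there the terms vanish or cancel in characteristic two. -/
theorem dartValue_add (hh : Matrix.vecMul h (edgeTriangle K) = 0) {a b c : V}
    (hf : {a, b, c} ∈ K.faces) :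
    dartValue h a b + dartValue h b c = dartValue h a c := by
  have h2 : ∀ x : ZMod 2, x + x = 0 := by decide
  by_cases hab : a = b
  · subst hab
    rw [dartValue_self, zero_add]
  by_cases hbc : b = c
  · subst hbc
    rw [dartValue_self, add_zero]
  by_cases hac : a = c
  · subst hac
    rw [dartValue_self, dartValue_comm h b a, h2]
  have ht : {a, b, c} ∈ triangles K :=
    mem_triangles.2 ⟨hf, Finset.card_eq_three.2 ⟨_, _, _, hab, hac, hbc, rfl⟩⟩
  have hE : ∀ x y, x ≠ y → {x, y} ⊆ ({a, b, c} : Finset V) → {x, y} ∈ edges K :=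
    fun x y hxy hs => mem_edges.2 (isEdge_of_subset ht hs (Finset.card_pair hxy))
  have hv : ∀ x y, ∀ h' : {x, y} ∈ edges K, dartValue h x y = h ⟨_, h'⟩ := fun x y h' => by
    rw [dartValue, dif_pos h']
  have e1 := hE a b hab (by grind)
  have e2 := hE b c hbc (by grind)
  have e3 := hE a c hac (by grind)
  have h1 := congrFun hh ⟨_, ht⟩
  simp only [Matrix.vecMul, dotProduct, edgeTriangle, mul_ite, mul_one, mul_zero,
    Pi.zero_apply] at h1
  rw [← Finset.sum_filter] at h1
  have hset : (Finset.univ.filter fun e : edges K => e.1 ⊆ {a, b, c}) =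
      {⟨_, e1⟩, ⟨_, e2⟩, ⟨_, e3⟩} := by
    ext ⟨e, he⟩
    simp only [Finset.mem_filter, Finset.mem_univ, true_and, Finset.mem_insert,
      Finset.mem_singleton, Subtype.mk.injEq]
    constructor
    · intro hs
      obtain ⟨x, y, hxy, rfl⟩ := Finset.card_eq_two.1 (mem_edges.1 he).2
      have hx := hs (show x ∈ _ by simp)
      have hy := hs (show y ∈ _ by simp)
      simp only [Finset.mem_insert, Finset.mem_singleton] at hx hy
      rcases hx with rfl | rfl | rfl <;> rcases hy with rfl | rfl | rfl <;>
        simp_all [Finset.pair_comm]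
    · rintro (rfl | rfl | rfl) <;> grind
  have n1 : a ∉ ({b, c} : Finset V) := by simp [hab, hac]
  have n2 : b ∉ ({a, c} : Finset V) := by simp [Ne.symm hab, hbc]
  have n3 : ({a, b} : Finset V) ≠ {b, c} := fun e => n1 (e ▸ by simp)
  have n4 : ({a, b} : Finset V) ≠ {a, c} := fun e => n2 (e ▸ by simp)
  have n5 : ({b, c} : Finset V) ≠ {a, c} := fun e => n2 (e ▸ by simp)
  rw [hset, Finset.sum_insert (by simp [n3, n4]), Finset.sum_insert (by simp [n5]),
    Finset.sum_singleton, ← hv _ _ e1, ← hv _ _ e2, ← hv _ _ e3, ← add_assoc] at h1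
  have h3 := h2 (dartValue h a c)
  exact add_right_cancel (h1.trans h3.symm)

theorem pathSum_homotopy (hh : Matrix.vecMul h (edgeTriangle K) = 0) {l l' : List V}
    (hl : Relation.EqvGen (ElementaryHomotopy K) l l') : pathSum h l = pathSum h l' := by
  induction hl with
  | rel l l' hl =>
    obtain ⟨x, y, a, b, c, hf, rfl, rfl⟩ := hl
    simp only [List.append_assoc, List.cons_append, List.nil_append]
    rw [pathSum_append, pathSum_append h x (c :: y)]
    simp only [pathSum]
    rw [← dartValue_add hh hf, add_assoc]
  | refl => rfl
  | symm _ _ _ ih => exact ih.symm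
  | trans _ _ _ _ _ ih1 ih2 => exact ih1.trans ih2

/-- Every cocycle modulo two of a disk is a coboundary. -/
theorem IsDisk.exists_potential (hK : IsDisk K) (hh : Matrix.vecMul h (edgeTriangle K) = 0) :
    ∃ g : V → ZMod 2, Matrix.mulVec (edgeVertex K) g = h := by
  have h2 : ∀ x y : ZMod 2, x + y = 0 → x = y := by decide
  obtain ⟨v₀⟩ := hK.connected.nonempty
  have hp : ∀ v, Nonempty ((oneSkeleton K).Walk v₀ v) := hK.connected.preconnected v₀
  let p : ∀ v, (oneSkeleton K).Walk v₀ v := fun v => (hp v).some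
  -- The potential at `v` is the sum of the cocycle along a chosen walk from the base point.
  refine ⟨fun v => pathSum h (p v).support, ?_⟩
  ext ⟨e, he⟩
  obtain ⟨a, b, hab, rfl⟩ := Finset.card_eq_two.1 (mem_edges.1 he).2
  have hadj : (oneSkeleton K).Adj a b := ⟨hab, (mem_edges.1 he).1⟩
  have hsum : Matrix.mulVec (edgeVertex K) (fun v => pathSum h (p v).support) ⟨{a, b}, he⟩ =
      pathSum h (p a).support + pathSum h (p b).support := by
    simp only [Matrix.mulVec, dotProduct, edgeVertex, ite_mul, one_mul, zero_mul]
    rw [← Finset.sum_filter, Finset.filter_mem_eq_inter, Finset.univ_inter, Finset.sum_pair hab]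
  rw [hsum]
  have hpath : IsEdgePath K ((p a).support ++ (p b).support.reverse) := by
    have hchain : ∀ v, List.IsChain (fun a b => {a, b} ∈ K.faces) (p v).support := fun v =>
      (p v).isChain_adj_support.imp fun x y hxy => hxy.2
    refine List.isChain_append.2 ⟨hchain a, List.isChain_reverse.2 ?_, ?_⟩
    · exact (hchain b).imp fun x y hxy => by rwa [Finset.pair_comm]
    · intro x hx y hy
      rw [List.getLast?_eq_some_getLast (by simp), Option.mem_some_iff] at hx
      rw [List.head?_reverse, List.getLast?_eq_some_getLast (by simp), Option.mem_some_iff] at hy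
      simp only [SimpleGraph.Walk.getLast_support] at hx hy
      subst hx hy
      exact hadj.2
  have hform : (p a).support ++ (p b).support.reverse =
      v₀ :: ((p a).support.tail ++ (p b).support.tail.reverse) ++ [v₀] := by
    have ha := (p a).cons_tail_support
    have hb := congrArg List.reverse (p b).cons_tail_support
    rw [List.reverse_cons] at hb
    rw [← List.cons_append, ha, List.append_assoc, hb]
  -- The loop runs to `a`, crosses the edge to `b` and returns to the base point. It is
  -- null-homotopic, so its sum is zero, which is the required equation for the edge.
  have hzero := pathSum_homotopy hh (hK.simply_connected v₀ _ (hform ▸ hpath))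
  rw [← hform] at hzero
  simp only [pathSum, dartValue_self, add_zero] at hzero
  obtain ⟨l, hl⟩ : ∃ l, (p a).support = l ++ [a] :=
    ⟨(p a).support.dropLast, by
      conv_lhs => rw [← List.dropLast_append_getLast (p a).support_ne_nil]
      simp⟩
  obtain ⟨l', hl'⟩ : ∃ l', (p b).support.reverse = b :: l' := by
    refine ⟨(p b).reverse.support.tail, ?_⟩
    rw [SimpleGraph.Walk.cons_tail_support, SimpleGraph.Walk.support_reverse]
  rw [hl, hl', List.append_assoc, List.singleton_append, pathSum_append, ← hl] at hzero
  simp only [pathSum] at hzero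
  rw [← hl', pathSum_reverse, dartValue, dif_pos he] at hzero
  refine h2 _ _ ?_
  rw [← hzero]
  ring

/-- Every 3-cycle of edges of a disk bounds a chain of triangles modulo two. -/
theorem IsDisk.exists_filling (hK : IsDisk K) {S : Finset V} (hS : S.card = 3)
    (hE : ∀ e ⊆ S, e.card = 2 → IsEdge K e) :
    ∃ c : triangles K → ZMod 2, Matrix.mulVec (edgeTriangle K) c = edgeChain K S := by
  by_contra hne
  have hnot : edgeChain K S ∉ LinearMap.range (edgeTriangle K).mulVecLin := by
    rintro ⟨c, hc⟩
    exact hne ⟨c, hc⟩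
  -- Duality: if the 3-cycle bounds nothing, some functional kills all boundaries but not the
  -- 3-cycle. As a cochain it is a cocycle, hence the coboundary of some `g`, and its value on the
  -- 3-cycle is `g` paired with the zero boundary of the cycle.
  obtain ⟨φ, hφ, hker⟩ := Submodule.exists_le_ker_of_notMem hnot
  classical
  let h : edges K → ZMod 2 := fun e => φ (Pi.single e 1)
  have hφh : ∀ x, φ x = dotProduct h x := fun x => by
    rw [LinearMap.pi_apply_eq_sum_univ φ x]
    refine Finset.sum_congr rfl fun e _ => ?_
    rw [smul_eq_mul, mul_comm]
    congr 2
    ext e'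
    simp [Pi.single_apply, eq_comm]
  have hh : Matrix.vecMul h (edgeTriangle K) = 0 := by
    ext t
    have : φ ((edgeTriangle K).mulVecLin (Pi.single t 1)) = 0 := hker ⟨_, rfl⟩
    rw [hφh, Matrix.mulVecLin_apply, Matrix.dotProduct_mulVec] at this
    simpa using this
  obtain ⟨g, hg⟩ := hK.exists_potential hh
  refine hφ ?_
  rw [hφh, ← hg, dotProduct_comm, Matrix.dotProduct_mulVec, edgeChain_vecMul hS hE,
    zero_dotProduct]

end Edges

/-! ### Second homology and the Euler characteristic -/

namespace Triangulation

variable {V : Type u} [Fintype V] [DecidableEq V] {T : Triangulation V}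

/-- A disk has no 2-cycles modulo two. -/
theorem edgeTriangle_mulVec_injective :
    Function.Injective (Matrix.mulVec (edgeTriangle T.cx)) := by
  rw [← Matrix.coe_mulVecLin, injective_iff_map_eq_zero]
  intro c hc
  by_contra hne
  obtain ⟨t₀, ht₀⟩ := Function.ne_iff.1 hne
  -- The support of a 2-cycle is a closed surface: at each edge the coefficients sum to zero, so a
  -- nonzero one needs a partner.
  refine no_closed_surface (T := T) (I := {t | ∃ h : t ∈ triangles T.cx, c ⟨t, h⟩ ≠ 0})
    (fun t ht => ht.1) ⟨t₀.1, t₀.2, ht₀⟩ ?_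
  rintro t ⟨ht, hct⟩ e he hcard
  have hE := isEdge_of_subset ht he hcard
  have h1 := congrFun hc ⟨e, mem_edges.2 hE⟩
  simp only [Matrix.mulVecLin_apply, Matrix.mulVec, dotProduct, edgeTriangle, ite_mul, one_mul,
    zero_mul, Pi.zero_apply] at h1
  by_contra hno
  push Not at hno
  rw [Finset.sum_eq_single_of_mem ⟨t, ht⟩ (Finset.mem_univ _), if_pos he] at h1
  · exact hct h1
  · rintro ⟨t', ht'⟩ - hne'
    split_ifs with hs
    · by_contra h0
      exact hno t' ⟨ht', h0⟩ (fun h => hne' (Subtype.ext h)) hs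
    · rfl

/-- The Euler characteristic of a disk is one. -/
theorem euler : (triangles T.cx).card + Fintype.card V = (edges T.cx).card + 1 := by
  -- With F triangles, E edges and V vertices, the boundary map has rank F. Hence the cocycles have
  -- dimension E − F. They are the coboundaries (`h5`), of dimension V − 1, because only the
  -- constants have zero coboundary on a connected complex (`h6`).
  have h1 := LinearMap.finrank_range_of_inj (f := (edgeTriangle T.cx).mulVecLin)
    (by rw [Matrix.coe_mulVecLin]; exact edgeTriangle_mulVec_injective)
  have h2 := Matrix.rank_transpose (edgeTriangle T.cx)
  have h3 := LinearMap.finrank_range_add_finrank_ker (edgeTriangle T.cx).transpose.mulVecLin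
  have h4 := LinearMap.finrank_range_add_finrank_ker (edgeVertex T.cx).mulVecLin
  have h5 : LinearMap.ker (edgeTriangle T.cx).transpose.mulVecLin =
      LinearMap.range (edgeVertex T.cx).mulVecLin := by
    ext h
    constructor
    · intro hh
      rw [LinearMap.mem_ker, Matrix.mulVecLin_apply, Matrix.mulVec_transpose] at hh
      obtain ⟨g, hg⟩ := T.isDisk.exists_potential hh
      exact ⟨g, hg⟩
    · rintro ⟨g, rfl⟩
      rw [LinearMap.mem_ker, Matrix.mulVecLin_apply, Matrix.mulVecLin_apply, Matrix.mulVec_mulVec,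
        edgeTriangle_transpose_mul, Matrix.zero_mulVec]
  have h6 : LinearMap.ker (edgeVertex T.cx).mulVecLin =
      Submodule.span (ZMod 2) {(fun _ => 1 : V → ZMod 2)} := by
    have hval : ∀ (g : V → ZMod 2) (a b : V) (hab : a ≠ b) (he : {a, b} ∈ edges T.cx),
        Matrix.mulVec (edgeVertex T.cx) g ⟨{a, b}, he⟩ = g a + g b := by
      intro g a b hab he
      simp only [Matrix.mulVec, dotProduct, edgeVertex, ite_mul, one_mul, zero_mul]
      rw [← Finset.sum_filter, Finset.filter_mem_eq_inter, Finset.univ_inter,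
        Finset.sum_pair hab]
    have hz : ∀ x y : ZMod 2, x + y = 0 → x = y := by decide
    ext g
    rw [LinearMap.mem_ker, Matrix.mulVecLin_apply, Submodule.mem_span_singleton]
    constructor
    · intro hg
      refine ⟨g (T.corner 0), ?_⟩
      ext v
      simp only [Pi.smul_apply, smul_eq_mul, mul_one]
      refine connected_induction (T := T) (P := fun v => g (T.corner 0) = g v) rfl ?_ v
      intro a b hab ha
      have := congrFun hg ⟨_, mem_edges.2 (adj_isEdge hab)⟩
      rw [hval g a b hab.1] at this
      exact ha.trans (hz _ _ this)
    · rintro ⟨x, rfl⟩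
      ext ⟨e, he⟩
      obtain ⟨a, b, hab, rfl⟩ := Finset.card_eq_two.1 (mem_edges.1 he).2
      rw [hval _ a b hab]
      have : ∀ x : ZMod 2, x + x = 0 := by decide
      simp [this]
  have h7 : Module.finrank (ZMod 2) (Submodule.span (ZMod 2) {(fun _ => 1 : V → ZMod 2)}) = 1 :=
    finrank_span_singleton fun h0 => one_ne_zero (congrFun h0 (T.corner 0))
  rw [h6, h7] at h4
  rw [h5] at h3
  simp only [Matrix.rank, Module.finrank_fintype_fun_eq_card, Fintype.card_coe] at h1 h2 h3 h4
  omega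

end Triangulation

namespace Triangulation

variable {V : Type u} [Fintype V] [DecidableEq V] {T : Triangulation V}

/-! ### Counting faces -/

theorem card_trianglesAt {e : Finset V} (he : IsEdge T.cx e) :
    (trianglesAt T.cx e).card = 1 ∨ (trianglesAt T.cx e).card = 2 := by
  have h1 : (trianglesAt T.cx e).card ≤ 2 := T.isDisk.edge_card_le e he
  obtain ⟨t, ht, hs⟩ := T.isDisk.pure e he.1
  have h2 : 0 < (trianglesAt T.cx e).card := Finset.card_pos.2 ⟨t, mem_trianglesAt.2 ⟨ht, hs⟩⟩
  omega

theorem card_boundaryEdges :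
    ((edges T.cx).filter fun e => (trianglesAt T.cx e).card = 1).card = 4 := by
  have h : ((edges T.cx).filter fun e => (trianglesAt T.cx e).card = 1) =
      Finset.univ.image fun i : Fin 4 => ({T.corner i, T.corner (i + 1)} : Finset V) := by
    ext e
    rw [Finset.mem_filter, mem_edges, Finset.mem_image]
    refine (T.boundary_iff e).trans ?_
    simp [eq_comm]
  rw [h, Finset.card_image_of_injective, Finset.card_univ, Fintype.card_fin]
  intro i j hij
  change ({T.corner i, T.corner (i + 1)} : Finset V) = {T.corner j, T.corner (j + 1)} at hij
  have h1 : T.corner i ∈ ({T.corner j, T.corner (j + 1)} : Finset V) := by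
    rw [← hij]; simp
  have h2 : T.corner (i + 1) ∈ ({T.corner j, T.corner (j + 1)} : Finset V) := by
    rw [← hij]; simp
  simp only [Finset.mem_insert, Finset.mem_singleton, T.corner_injective.eq_iff] at h1 h2
  clear hij h
  revert i j
  decide

/-- Incidences of edges and triangles: each triangle has three edges, and each edge lies in two
triangles except the four boundary edges, which lie in one. -/
theorem three_mul_card_triangles :
    3 * (triangles T.cx).card + 4 = 2 * (edges T.cx).card := by
  have h := Finset.sum_card_bipartiteAbove_eq_sum_card_bipartiteBelow
    (fun e t : Finset V => e ⊆ t) (s := edges T.cx) (t := triangles T.cx)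
  have h1 : ∀ e ∈ edges T.cx, (Finset.bipartiteAbove (fun e t : Finset V => e ⊆ t)
      (triangles T.cx) e).card + (if (trianglesAt T.cx e).card = 1 then 1 else 0) = 2 := by
    intro e he
    change (trianglesAt T.cx e).card + _ = 2
    rcases card_trianglesAt (mem_edges.1 he) with h | h <;> simp [h]
  have h2 : ∀ t ∈ triangles T.cx, (Finset.bipartiteBelow (fun e t : Finset V => e ⊆ t)
      (edges T.cx) t).card = 3 := by
    intro t ht
    have : Finset.bipartiteBelow (fun e t : Finset V => e ⊆ t) (edges T.cx) t =
        t.powersetCard 2 := by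
      ext e
      rw [Finset.mem_bipartiteBelow, Finset.mem_powersetCard, mem_edges]
      exact ⟨fun h => ⟨h.2, h.1.2⟩, fun h => ⟨isEdge_of_subset ht h.1 h.2, h.1⟩⟩
    rw [this, Finset.card_powersetCard, (mem_triangles.1 ht).2]
    rfl
  rw [Finset.sum_congr rfl h2, Finset.sum_const, smul_eq_mul] at h
  have h3 := Finset.sum_congr rfl h1
  rw [Finset.sum_add_distrib, h, Finset.sum_const, smul_eq_mul, Finset.sum_boole,
    card_boundaryEdges] at h3
  simp only [Nat.cast_ofNat] at h3
  omega

theorem mem_interiorVertices {v : V} :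
    v ∈ T.interiorVertices ↔ ∀ i, v ≠ T.corner i := by
  simp [interiorVertices]

theorem card_interiorVertices : T.interiorVertices.card + 4 = Fintype.card V := by
  have h : Finset.univ \ T.interiorVertices = Finset.univ.image T.corner := by
    ext v
    simp [mem_interiorVertices, eq_comm]
  rw [← Finset.card_univ, ← Finset.card_sdiff_add_card_eq_card
    (Finset.subset_univ T.interiorVertices), h,
    Finset.card_image_of_injective _ T.corner_injective, Finset.card_univ, Fintype.card_fin,
    add_comm]

theorem card_triangles : (triangles T.cx).card = 2 * T.interiorVertices.card + 2 := by
  have h1 := T.euler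
  have h2 := T.three_mul_card_triangles
  have h3 := T.card_interiorVertices
  omega

/-! ### The inside of a 3-cycle -/

theorem CrossAdj.symm {S t t' : Finset V} (h : T.CrossAdj S t t') : T.CrossAdj S t' t := by
  obtain ⟨h1, h2, e, h3, h4, h5, h6⟩ := h
  exact ⟨h2, h1, e, h3, h5, h4, h6⟩

theorem CrossAdj.isOutside {S t t' : Finset V} (h : T.CrossAdj S t t') (ht : T.IsOutside S t) :
    T.IsOutside S t' := by
  obtain ⟨t₁, h1, h2⟩ := ht
  exact ⟨t₁, h1.head h.symm, h2⟩

theorem CrossAdj.isInside {S t t' : Finset V} (h : T.CrossAdj S t t') (ht : T.IsInside S t) :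
    T.IsInside S t' :=
  ⟨h.2.1, fun h' => ht.2 (h.symm.isOutside h')⟩

/-- The triangles at `v` are connected through edges containing `v`, and none of these lies on the
3-cycle. -/
theorem isInside_star {S t t' : Finset V} {v : V} (hv : v ∉ S) (ht : T.IsInside S t)
    (hvt : v ∈ t) (ht' : t' ∈ triangles T.cx) (hvt' : v ∈ t') : T.IsInside S t' := by
  refine star_induction (P := T.IsInside S) ht.1 hvt ht (fun t t' a h h' ha hs hs' hP => ?_)
    ht' hvt'
  exact CrossAdj.isInside ⟨h, h', {v, a}, isEdge_of_subset h hs (Finset.card_pair ha.symm), hs,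
    hs', fun h => hv (h (by simp))⟩ hP

/-- A corner off the cycle would put the triangle of a boundary edge inside, although that edge
opens to the attached square. -/
theorem interior_of_isInside {S t : Finset V} {v : V} (hv : v ∉ S) (ht : T.IsInside S t)
    (hvt : v ∈ t) (i : Fin 4) : v ≠ T.corner i := by
  rintro rfl
  obtain ⟨c, hc⟩ := isDart_corner (T := T) i
  have h1 := isInside_star hv ht hvt (T.pos_triangle _ _ _ hc) (by simp)
  exact h1.2 ⟨_, .refl, _, (T.boundary_iff _).2 ⟨i, rfl⟩, by grind, fun h => hv (h (by simp))⟩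

/-- If `v` lies strictly inside `S`, then everything inside a 3-cycle through `v` is inside `S`. -/
theorem isInside_of_isInside {S t t₀ : Finset V} {v w z : V} (hv : v ∉ S)
    (ht₀ : T.IsInside S t₀) (hvt₀ : v ∈ t₀) (hw : (oneSkeleton T.cx).Adj v w)
    (hz : (oneSkeleton T.cx).Adj v z) (ht : T.IsInside {v, w, z} t) : T.IsInside S t := by
  refine ⟨ht.1, fun hout => ht.2 ?_⟩
  have hadj : ∀ u, (oneSkeleton T.cx).Adj v u → u ∉ S → ∀ t ∈ triangles T.cx, u ∈ t →
      T.IsInside S t := by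
    intro u hu huS t ht hut
    obtain ⟨t₁, ht₁, hs⟩ := T.isDisk.pure _ hu.2
    exact isInside_star huS (isInside_star hv ht₀ hvt₀ ht₁ (hs (by simp))) (hs (by simp)) ht hut
  -- An escape route avoiding `S` also avoids the cycle `v, w, z`. An edge of that cycle not on `S`
  -- has an end off `S`, and this end is `v` or a neighbour of `v`, so all triangles there are
  -- inside `S`.
  have hcross : ∀ e t, ¬ e ⊆ S → e ⊆ t → t ∈ triangles T.cx → T.IsOutside S t →
      ¬ e ⊆ {v, w, z} := by
    intro e t heS het htri hout he
    obtain ⟨u, hue, huS⟩ := Finset.not_subset.1 heS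
    have hu := he hue
    simp only [Finset.mem_insert, Finset.mem_singleton] at hu
    have : T.IsInside S t := by
      rcases hu with rfl | rfl | rfl
      · exact isInside_star hv ht₀ hvt₀ htri (het hue)
      · exact hadj _ hw huS _ htri (het hue)
      · exact hadj _ hz huS _ htri (het hue)
    exact this.2 hout
  obtain ⟨t', hpath, e, he, het, heS⟩ := hout
  have htri := ht.1
  clear ht
  induction hpath using Relation.ReflTransGen.head_induction_on with
  | refl =>
    exact ⟨t', .refl, e, he, het, hcross e t' heS het htri ⟨t', .refl, e, he, het, heS⟩⟩
  | @head t t₁ h h' ih =>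
    obtain ⟨t'', h1, h2⟩ := ih h.2.1
    refine ⟨t'', h1.head ?_, h2⟩
    obtain ⟨a1, a2, e', a3, a4, a5, a6⟩ := h
    exact ⟨a1, a2, e', a3, a4, a5, hcross e' t₁ a6 a5 a2 ⟨t', h', e, he, het, heS⟩⟩

/-! ### The Jordan curve theorem for 3-cycles -/

theorem edgeTriangle_mulVec {K : AbstractSimplicialComplex V} (f : Finset V → ZMod 2)
    (e : edges K) :
    Matrix.mulVec (edgeTriangle K) (fun t => f t.1) e = ∑ t ∈ trianglesAt K e.1, f t := by
  simp only [Matrix.mulVec, dotProduct, edgeTriangle, ite_mul, one_mul, zero_mul, trianglesAt]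
  rw [Finset.sum_filter, ← Finset.sum_coe_sort (triangles K)]

theorem sum_trianglesAt_of_pair {e t t' : Finset V} (he : IsEdge T.cx e)
    (ht : t ∈ triangles T.cx) (ht' : t' ∈ triangles T.cx) (hs : e ⊆ t) (hs' : e ⊆ t')
    (hne : t ≠ t') (f : Finset V → ZMod 2) : ∑ t ∈ trianglesAt T.cx e, f t = f t + f t' := by
  have h : {t, t'} = trianglesAt T.cx e := by
    refine Finset.eq_of_subset_of_card_le ?_ ?_
    · intro s
      simp only [Finset.mem_insert, Finset.mem_singleton]
      rintro (rfl | rfl)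
      · exact mem_trianglesAt.2 ⟨ht, hs⟩
      · exact mem_trianglesAt.2 ⟨ht', hs'⟩
    · rw [Finset.card_pair hne]
      exact T.isDisk.edge_card_le e he
  rw [← h, Finset.sum_pair hne]

theorem sum_trianglesAt_of_boundary {e t : Finset V} (he : IsBoundaryEdge T.cx e)
    (ht : t ∈ triangles T.cx) (hs : e ⊆ t) (f : Finset V → ZMod 2) :
    ∑ t ∈ trianglesAt T.cx e, f t = f t := by
  obtain ⟨t', h⟩ := Finset.card_eq_one.1 he.2
  have : t ∈ trianglesAt T.cx e := mem_trianglesAt.2 ⟨ht, hs⟩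
  rw [h, Finset.mem_singleton] at this
  rw [h, Finset.sum_singleton, this]

/-- A chain whose boundary is supported on `S` vanishes outside `S`. -/
theorem eq_zero_of_isOutside {S : Finset V} {f : Finset V → ZMod 2}
    (hf : ∀ e, IsEdge T.cx e → ¬ e ⊆ S → ∑ t ∈ trianglesAt T.cx e, f t = 0) {t : Finset V}
    (ht : t ∈ triangles T.cx) (hout : T.IsOutside S t) : f t = 0 := by
  have h2 : ∀ x y : ZMod 2, x + y = 0 → x = y := by decide
  obtain ⟨t', hpath, e, he, het, heS⟩ := hout
  induction hpath using Relation.ReflTransGen.head_induction_on with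
  | refl => rw [← sum_trianglesAt_of_boundary he ht het f, hf e he.1 heS]
  | @head t t₁ h _ ih =>
    obtain ⟨a1, a2, e', a3, a4, a5, a6⟩ := h
    by_cases hne : t = t₁
    · exact hne ▸ ih a2
    · have h3 := hf e' a3 a6
      rw [sum_trianglesAt_of_pair a3 a1 a2 a4 a5 hne] at h3
      rw [h2 _ _ h3, ih a2]

/-- The indicator function modulo two of the inside of `S`. -/
noncomputable def insideChain (T : Triangulation V) (S t : Finset V) : ZMod 2 :=
  open Classical in if T.IsInside S t then 1 else 0

theorem insideChain_of_isInside {S t : Finset V} (h : T.IsInside S t) :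
    T.insideChain S t = 1 := by
  simp [insideChain, h]

theorem insideChain_of_not_isInside {S t : Finset V} (h : ¬ T.IsInside S t) :
    T.insideChain S t = 0 := by
  simp [insideChain, h]

/-- The two triangles at an interior edge off `S` are on the same side of `S`; at a boundary edge
off `S` the only triangle is outside. -/
theorem sum_insideChain_of_not_subset {S e : Finset V} (he : IsEdge T.cx e) (hS : ¬ e ⊆ S) :
    ∑ t ∈ trianglesAt T.cx e, T.insideChain S t = 0 := by
  have h2 : ∀ x : ZMod 2, x + x = 0 := by decide
  rcases card_trianglesAt he with hc | hc
  · obtain ⟨t, ht, hs⟩ := T.isDisk.pure e he.1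
    rw [sum_trianglesAt_of_boundary ⟨he, hc⟩ ht hs, insideChain_of_not_isInside]
    exact fun h => h.2 ⟨t, .refl, e, ⟨he, hc⟩, hs, hS⟩
  · obtain ⟨t, t', hne, ht⟩ := Finset.card_eq_two.1 hc
    have h1 : t ∈ trianglesAt T.cx e := by simp [ht]
    have h3 : t' ∈ trianglesAt T.cx e := by simp [ht]
    rw [mem_trianglesAt] at h1 h3
    have hcr : T.CrossAdj S t t' := ⟨h1.1, h3.1, e, he, h1.2, h3.2, hS⟩
    rw [ht, Finset.sum_pair hne]
    by_cases hin : T.IsInside S t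
    · rw [insideChain_of_isInside hin, insideChain_of_isInside (hcr.isInside hin), h2]
    · rw [insideChain_of_not_isInside hin,
        insideChain_of_not_isInside fun h => hin (hcr.symm.isInside h), add_zero]

/-- A cycle supported on the 3-cycle `S` is a multiple of it. -/
theorem eq_smul_edgeChain {S : Finset V} (hS : T.IsSubdivision S) {x : edges T.cx → ZMod 2}
    (hx : Matrix.vecMul x (edgeVertex T.cx) = 0) (h0 : ∀ e, ¬ e.1 ⊆ S → x e = 0) :
    ∃ k : ZMod 2, x = k • edgeChain T.cx S := by
  have h2 : ∀ x y : ZMod 2, x + y = 0 → x = y := by decide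
  obtain ⟨hcard, hE, -⟩ := hS
  obtain ⟨a, b, c, hab, hac, hbc, rfl⟩ := Finset.card_eq_three.1 hcard
  -- At a vertex of the 3-cycle only two edges can carry `x`, and the vanishing boundary makes their
  -- coefficients equal.
  have key : ∀ u v w, u ≠ v → u ≠ w → v ≠ w → ({u, v, w} : Finset V) = {a, b, c} →
      ∀ (h1 : {u, v} ∈ edges T.cx) (h2 : {u, w} ∈ edges T.cx),
      x ⟨_, h1⟩ = x ⟨_, h2⟩ := by
    intro u v w huv huw hvw hS h1 h3
    have hu := congrFun hx u
    have hsum : ∑ e ∈ ({⟨_, h1⟩, ⟨_, h3⟩} : Finset (edges T.cx)), x e * edgeVertex T.cx e u =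
        Matrix.vecMul x (edgeVertex T.cx) u := by
      refine Finset.sum_subset (Finset.subset_univ _) ?_
      rintro ⟨e, he⟩ - hne
      simp only [Finset.mem_insert, Finset.mem_singleton, Subtype.mk.injEq, not_or] at hne
      by_cases hue : u ∈ e
      · rw [h0, zero_mul]
        intro hs
        change e ⊆ _ at hs
        rw [← hS] at hs
        obtain ⟨y, hy⟩ := Finset.card_eq_one.1
          (show (e.erase u).card = 1 by
            rw [Finset.card_erase_of_mem hue, (mem_edges.1 he).2])
        rw [← Finset.insert_erase hue, hy] at hs hne
        have hyu : y ≠ u := by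
          have : y ∈ e.erase u := by simp [hy]
          exact (Finset.mem_erase.1 this).1
        have hys := hs (show y ∈ _ by simp)
        simp only [Finset.mem_insert, Finset.mem_singleton] at hys
        rcases hys with rfl | rfl | rfl
        · exact hyu rfl
        · exact hne.1 rfl
        · exact hne.2 rfl
      · simp [edgeVertex, hue]
    have hvw' : v ∉ ({u, w} : Finset V) := by simp [huv.symm, hvw]
    rw [hu, Finset.sum_pair (fun h => hvw' (by rw [← Subtype.mk.inj h]; simp))] at hsum
    simp only [edgeVertex, Finset.mem_insert, true_or, if_true, mul_one, Pi.zero_apply] at hsum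
    exact h2 _ _ hsum
  have e1 : {a, b} ∈ edges T.cx := mem_edges.2 (hE _ (by grind) (Finset.card_pair hab))
  have e2 : {a, c} ∈ edges T.cx := mem_edges.2 (hE _ (by grind) (Finset.card_pair hac))
  have e3 : {b, c} ∈ edges T.cx := mem_edges.2 (hE _ (by grind) (Finset.card_pair hbc))
  have e1' : {b, a} ∈ edges T.cx := by rwa [Finset.pair_comm]
  have k1 := key a b c hab hac hbc rfl e1 e2
  have k2 := key b a c hab.symm hbc hac (Finset.insert_comm _ _ _) e1' e3
  have k3 : x ⟨_, e1'⟩ = x ⟨_, e1⟩ := by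
    congr 2
    exact Finset.pair_comm _ _
  refine ⟨x ⟨_, e1⟩, ?_⟩
  ext ⟨e, he⟩
  by_cases hs : e ⊆ {a, b, c}
  · simp only [Pi.smul_apply, edgeChain, hs, if_true, smul_eq_mul, mul_one]
    obtain ⟨y, z, hyz, rfl⟩ := Finset.card_eq_two.1 (mem_edges.1 he).2
    have hy := hs (show y ∈ _ by simp)
    have hz := hs (show z ∈ _ by simp)
    have hcomm : ∀ (y z : V) (h : {y, z} ∈ edges T.cx) (h' : {z, y} ∈ edges T.cx),
        x ⟨_, h⟩ = x ⟨_, h'⟩ := fun y z h h' => by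
      congr 2
      exact Finset.pair_comm _ _
    simp only [Finset.mem_insert, Finset.mem_singleton] at hy hz
    rcases hy with rfl | rfl | rfl <;> rcases hz with rfl | rfl | rfl
    · exact absurd rfl hyz
    · rfl
    · exact k1.symm
    · exact k3
    · exact absurd rfl hyz
    · rw [← k2, k3]
    · rw [k1, hcomm]
    · rw [hcomm _ _ he e3, ← k2, k3]
    · exact absurd rfl hyz
  · simp [h0 ⟨e, he⟩ hs, edgeChain, hs]

/-- The boundary of the inside of a 3-cycle is the 3-cycle. -/
theorem sum_insideChain {S : Finset V} (hS : T.IsSubdivision S) :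
    Matrix.mulVec (edgeTriangle T.cx) (fun t => T.insideChain S t.1) = edgeChain T.cx S := by
  obtain ⟨c, hc⟩ := T.isDisk.exists_filling hS.1 hS.2.1
  let f : Finset V → ZMod 2 := fun t => if h : t ∈ triangles T.cx then c ⟨t, h⟩ else 0
  have hfc : (fun t : triangles T.cx => f t.1) = c := by
    ext t
    simp [f]
  have hf : ∀ e, IsEdge T.cx e → ¬ e ⊆ S → ∑ t ∈ trianglesAt T.cx e, f t = 0 := by
    intro e he heS
    rw [← edgeTriangle_mulVec f ⟨e, mem_edges.2 he⟩, hfc, hc]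
    simp [edgeChain, heS]
  set d : triangles T.cx → ZMod 2 := fun t => T.insideChain S t.1 with hd
  have hin : ∀ t, c t ≠ 0 → d t = 1 := by
    intro t ht
    refine insideChain_of_isInside ⟨t.2, fun hout => ht ?_⟩
    rw [← hfc]
    exact eq_zero_of_isOutside hf t.2 hout
  -- The filling `c` vanishes outside `S`, so its support lies in that of the inside chain `d`. The
  -- boundary of `c + d` is a cycle on `S`, hence zero or the whole 3-cycle. In the first case `c =
  -- d`. In the second `d` has zero boundary, so `d = 0`, and `c = 0` by the inclusion of supports.
  obtain ⟨k, hk⟩ := eq_smul_edgeChain hS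
    (x := Matrix.mulVec (edgeTriangle T.cx) (c + d)) (by
      rw [← Matrix.vecMul_transpose, Matrix.vecMul_vecMul, edgeTriangle_transpose_mul,
        Matrix.vecMul_zero]) (by
      intro e heS
      rw [Matrix.mulVec_add, Pi.add_apply, hc, edgeTriangle_mulVec,
        sum_insideChain_of_not_subset (mem_edges.1 e.2) heS]
      simp [edgeChain, heS])
  have hk2 : ∀ k : ZMod 2, k = 0 ∨ k = 1 := by decide
  have h2 : ∀ x y : ZMod 2, x + y = 0 → x = y := by decide
  rcases hk2 k with rfl | rfl
  · have h0 : c + d = 0 := edgeTriangle_mulVec_injective (by rw [hk, zero_smul, Matrix.mulVec_zero])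
    have : c = d := funext fun t => h2 _ _ (congrFun h0 t)
    rw [← this, hc]
  · have h0 : c + d = c := edgeTriangle_mulVec_injective (by rw [hk, one_smul, hc])
    have hd0 : d = 0 := add_left_cancel (h0.trans (add_zero c).symm)
    have hc0 : c = 0 := by
      ext t
      by_contra ht
      have := hin t ht
      rw [hd0] at this
      exact zero_ne_one this
    rw [hd0, ← hc0, hc]

/-- An empty inside would have zero boundary, whereas its boundary is the 3-cycle. -/
theorem exists_isInside {S : Finset V} (hS : T.IsSubdivision S) : ∃ t, T.IsInside S t := by
  by_contra hno
  push Not at hno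
  have h := sum_insideChain hS
  obtain ⟨e, he, hc⟩ : ∃ e ⊆ S, e.card = 2 :=
    Finset.exists_subset_card_eq (by rw [hS.1]; norm_num)
  have h1 := congrFun h ⟨e, mem_edges.2 (hS.2.1 e he hc)⟩
  rw [edgeTriangle_mulVec, Finset.sum_eq_zero fun t _ => insideChain_of_not_isInside (hno t)] at h1
  simp [edgeChain, he] at h1

/-- An interior edge of a 3-cycle has a triangle that is not inside the 3-cycle. -/
theorem exists_not_isInside {S e : Finset V} (hS : T.IsSubdivision S) (he : IsInteriorEdge T.cx e)
    (heS : e ⊆ S) : ∃ t ∈ triangles T.cx, e ⊆ t ∧ ¬ T.IsInside S t := by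
  by_contra hno
  push Not at hno
  have h1 := congrFun (sum_insideChain hS) ⟨e, mem_edges.2 he.1⟩
  rw [edgeTriangle_mulVec, Finset.sum_congr rfl fun t ht => insideChain_of_isInside
    (hno t (mem_trianglesAt.1 ht).1 (mem_trianglesAt.1 ht).2)] at h1
  rcases card_trianglesAt he.1 with hc | hc
  · exact he.2 ⟨he.1, hc⟩
  · simp only [Finset.sum_const, hc, edgeChain, heS, if_true] at h1
    exact absurd h1 (by decide)

/-! ### The link condition -/

theorem identified_iff {x y : V} {s s' : Finset V} : T.Identified x y s s' ↔
    (s = {x} ∧ s' = {y}) ∨ ∃ z, {x, y, z} ∈ triangles T.cx ∧ s = {z, x} ∧ s' = {z, y} := by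
  constructor
  · rintro (_ | ⟨z, hz⟩)
    · exact Or.inl ⟨rfl, rfl⟩
    · exact Or.inr ⟨z, hz, rfl, rfl⟩
  · rintro (⟨rfl, rfl⟩ | ⟨z, hz, rfl, rfl⟩)
    · exact .vertex
    · exact .edge z hz

theorem isSubdivision_of_adj {x y z : V} (hxy : (oneSkeleton T.cx).Adj x y)
    (hxz : (oneSkeleton T.cx).Adj x z) (hyz : (oneSkeleton T.cx).Adj y z)
    (h : {x, y, z} ∉ triangles T.cx) : T.IsSubdivision {x, y, z} := by
  refine ⟨Finset.card_eq_three.2 ⟨_, _, _, hxy.1, hxz.1, hyz.1, rfl⟩, fun e he hc => ?_, h⟩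
  obtain ⟨a, b, hab, rfl⟩ := Finset.card_eq_two.1 hc
  have ha := he (show a ∈ _ by simp)
  have hb := he (show b ∈ _ by simp)
  simp only [Finset.mem_insert, Finset.mem_singleton] at ha hb
  refine adj_isEdge ?_
  rcases ha with rfl | rfl | rfl <;> rcases hb with rfl | rfl | rfl <;>
    first
    | exact absurd rfl hab
    | assumption
    | (apply SimpleGraph.Adj.symm; assumption)

/-- The boundary of a tetrahedron is a closed surface. -/
theorem no_tetrahedron {W : Finset V} (hW : W.card = 4)
    (h : ∀ t ⊆ W, t.card = 3 → t ∈ triangles T.cx) : False := by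
  refine no_closed_surface (T := T) (I := {t | t ⊆ W ∧ t.card = 3}) (fun t ht => h t ht.1 ht.2)
    (Finset.exists_subset_card_eq (by omega)) ?_
  rintro t ⟨ht, hc⟩ e he hce
  obtain ⟨u, huW, hut⟩ := Finset.exists_mem_notMem_of_card_lt_card (s := t) (t := W) (by omega)
  refine ⟨insert u e, ⟨Finset.insert_subset huW (he.trans ht), ?_⟩, fun h => ?_,
    Finset.subset_insert _ _⟩
  · rw [Finset.card_insert_of_notMem fun h => hut (he h), hce]
  · exact hut (h ▸ Finset.mem_insert_self _ _)

/-- An edge that cannot be contracted lies on a 3-cycle that does not bound a triangle. -/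
theorem exists_subdivision {x y : V} (hxy : (oneSkeleton T.cx).Adj x y)
    (h : ¬ T.CanContract x y) : ∃ z, T.IsSubdivision {x, y, z} := by
  have key : ∀ s ∈ T.cx.faces, ∀ s' ∈ T.cx.faces, x ∈ s → y ∈ s' → x ∉ s' → y ∉ s →
      (∀ u, u ≠ x → u ≠ y → (u ∈ s ↔ u ∈ s')) → ¬ T.Identified x y s s' →
      ∃ z, T.IsSubdivision {x, y, z} := by
    intro s hs s' hs' hx hy hx' hy' hu hid
    by_contra hno
    push Not at hno
    have hadj : ∀ u, u ≠ x → u ≠ y → u ∈ s → {x, y, u} ∈ triangles T.cx := by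
      intro u hux huy hus
      by_contra hn
      have h1 : {x, u} ∈ T.cx.faces := face_mono _ hs (by grind) (by simp)
      have h2 : {y, u} ∈ T.cx.faces := face_mono _ hs' (by grind) (by simp)
      exact hno u (isSubdivision_of_adj hxy ⟨hux.symm, h1⟩ ⟨huy.symm, h2⟩ hn)
    have hss' : s' = insert y (s.erase x) := by
      ext u
      have := hu u
      grind
    -- The clashing faces are `A` with `x` added and `A` with `y` added, and every vertex of `A`
    -- spans a triangle with `x, y`. If `A` has at most one vertex, the two faces are identified in
    -- the contraction; if it has two, all four faces of a tetrahedron occur.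
    obtain ⟨A, hA⟩ : ∃ A, A = s.erase x := ⟨_, rfl⟩
    have hsA : s = insert x A := by rw [hA, Finset.insert_erase hx]
    have hs'A : s' = insert y A := by rw [hss', hA]
    have hxA : x ∉ A := by simp [hA]
    have hyA : y ∉ A := fun h => hy' (by rw [hsA]; exact Finset.mem_insert_of_mem h)
    have hAc : A.card ≤ 2 := by
      have := T.isDisk.card_le s hs
      rw [hsA, Finset.card_insert_of_notMem hxA] at this
      omega
    have hAtri : ∀ u ∈ A, {x, y, u} ∈ triangles T.cx := fun u hu =>
      hadj u (fun h => hxA (h ▸ hu)) (fun h => hyA (h ▸ hu))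
        (by rw [hsA]; exact Finset.mem_insert_of_mem hu)
    have hc : A.card = 0 ∨ A.card = 1 ∨ A.card = 2 := by omega
    rcases hc with hc | hc | hc
    · rw [Finset.card_eq_zero] at hc
      exact hid (identified_iff.2 (Or.inl ⟨by simp [hsA, hc], by simp [hs'A, hc]⟩))
    · obtain ⟨z, rfl⟩ := Finset.card_eq_one.1 hc
      refine hid (identified_iff.2 (Or.inr ⟨z, hAtri z (by simp), ?_, ?_⟩))
      · rw [hsA, Finset.pair_comm]
      · rw [hs'A, Finset.pair_comm]
    · obtain ⟨z, w, hzw, rfl⟩ := Finset.card_eq_two.1 hc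
      have n := hxy.1
      have hW : ({x, y, z, w} : Finset V).card = 4 := by
        rw [Finset.card_insert_of_notMem, Finset.card_insert_of_notMem hyA, hc]
        grind
      refine no_tetrahedron (T := T) hW fun t ht htc => ?_
      have h1 : {x, z, w} ∈ triangles T.cx := by
        rw [← hsA]
        exact mem_triangles.2 ⟨hs, by rw [hsA, Finset.card_insert_of_notMem hxA, hc]⟩
      have h2 : {y, z, w} ∈ triangles T.cx := by
        rw [← hs'A]
        exact mem_triangles.2 ⟨hs', by rw [hs'A, Finset.card_insert_of_notMem hyA, hc]⟩
      have h3 := hAtri z (by simp)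
      have h4 := hAtri w (by simp)
      obtain ⟨u, huW, hut⟩ := Finset.exists_mem_notMem_of_card_lt_card
        (s := t) (t := {x, y, z, w}) (by omega)
      have ht' : t = ({x, y, z, w} : Finset V).erase u := by
        refine Finset.eq_of_subset_of_card_le (fun v hv => Finset.mem_erase.2
          ⟨fun h => hut (h ▸ hv), ht hv⟩) ?_
        rw [Finset.card_erase_of_mem huW]
        omega
      simp only [Finset.mem_insert, Finset.mem_singleton] at huW
      simp only [Finset.mem_insert, Finset.mem_singleton, not_or] at hxA hyA
      have conv : ∀ t' ∈ triangles T.cx, t = t' → t ∈ triangles T.cx := fun t' h e => e ▸ h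
      rcases huW with rfl | rfl | rfl | rfl
      · exact conv _ h2 (by rw [ht']; grind)
      · exact conv _ h1 (by rw [ht']; grind)
      · exact conv _ h4 (by rw [ht']; grind)
      · exact conv _ h3 (by rw [ht']; grind)
  unfold CanContract at h
  push Not at h
  obtain ⟨s, hs, s', hs', hn, hn', him, hne, hid, hid'⟩ := h
  have hmem : ∀ u, u ≠ x → u ≠ y → (u ∈ s ↔ u ∈ s') := by
    intro u hux huy
    have := Finset.ext_iff.1 him u
    simp only [Finset.mem_image] at this
    grind
  have hmem' : (x ∈ s ∨ y ∈ s) ↔ (x ∈ s' ∨ y ∈ s') := by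
    have := Finset.ext_iff.1 him x
    simp only [Finset.mem_image] at this
    grind
  have hns : ¬ (x ∈ s ∧ y ∈ s) := fun h => hn (by grind)
  have hns' : ¬ (x ∈ s' ∧ y ∈ s') := fun h => hn' (by grind)
  have hdiff : ¬ ((x ∈ s ↔ x ∈ s') ∧ (y ∈ s ↔ y ∈ s')) := fun h => hne (by
    ext u
    by_cases hux : u = x
    · exact hux ▸ h.1
    by_cases huy : u = y
    · exact huy ▸ h.2
    exact hmem u hux huy)
  by_cases hx : x ∈ s
  · exact key s hs s' hs' hx (by tauto) (by tauto) (by tauto) hmem hid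
  · exact key s' hs' s hs (by tauto) (by tauto) hx (by tauto)
      (fun u h1 h2 => (hmem u h1 h2).symm) hid'

/-- Contraction gives the edges `zx` and `zy` the same vertices, so they must be identified, which
only a triangle `xyz` does. -/
theorem CanContract.triangle {x y z : V} (h : T.CanContract x y)
    (hxy : (oneSkeleton T.cx).Adj x y) (hxz : (oneSkeleton T.cx).Adj x z)
    (hyz : (oneSkeleton T.cx).Adj y z) : {x, y, z} ∈ triangles T.cx := by
  have n1 := hxy.1
  have n2 := hxz.1
  have n3 := hyz.1
  have hne : ({z, x} : Finset V) ≠ {z, y} := fun e => by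
    have : x ∈ ({z, y} : Finset V) := e ▸ by simp
    grind
  rcases h {z, x} hxz.symm.2 {z, y} hyz.symm.2
    (fun h => by have := h (show y ∈ _ by simp); grind)
    (fun h => by have := h (show x ∈ _ by simp); grind)
    (by simp [n1, n3.symm]) with h | h | h
  · exact absurd h hne
  · rcases identified_iff.1 h with ⟨h1, -⟩ | ⟨z', hz', h1, -⟩
    · have : z ∈ ({x} : Finset V) := h1 ▸ by simp
      grind
    · have : z ∈ ({z', x} : Finset V) := h1 ▸ by simp
      simp only [Finset.mem_insert, Finset.mem_singleton, n2.symm, or_false] at this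
      exact this ▸ hz'
  · rcases identified_iff.1 h with ⟨h1, -⟩ | ⟨z', hz', h1, -⟩
    · have : y ∈ ({x} : Finset V) := h1 ▸ by simp
      grind
    · have : x ∈ ({z, y} : Finset V) := h1 ▸ by simp
      grind

end Triangulation

/-! ### Areas in the complex plane -/

/-- The determinant of two vectors. -/
def cross (p q : Fin 2 → ℂ) : ℂ := p 0 * q 1 - p 1 * q 0

theorem triArea_eq_cross (P Q R : Fin 2 → ℂ) :
    triArea P Q R = 1 / 2 * cross (Q - P) (R - P) := by
  simp [triArea, Matrix.det_fin_three, cross]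
  ring

/-- Splits the area into antisymmetric terms over the directed edges, so that interior edges cancel
in the sum over a region. -/
theorem triArea_eq_add (o P Q R : Fin 2 → ℂ) :
    triArea P Q R = 1 / 2 * cross (P - o) (Q - o) + 1 / 2 * cross (Q - o) (R - o) +
      1 / 2 * cross (R - o) (P - o) := by
  simp [triArea, Matrix.det_fin_three, cross]
  ring

theorem triArea_eq_zero_iff {P Q R : Fin 2 → ℂ} :
    triArea P Q R = 0 ↔ cross (Q - P) (R - P) = 0 := by
  rw [triArea_eq_cross]
  simp

theorem cross_comm (p q : Fin 2 → ℂ) : cross p q = -cross q p := by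
  simp only [cross]
  ring

theorem cross_self (p : Fin 2 → ℂ) : cross p p = 0 := by
  simp only [cross]
  ring

theorem zero_cross (p : Fin 2 → ℂ) : cross 0 p = 0 := by simp [cross]

theorem cross_zero (p : Fin 2 → ℂ) : cross p 0 = 0 := by simp [cross]

theorem cross_eq_zero_symm {p q : Fin 2 → ℂ} (h : cross p q = 0) : cross q p = 0 := by
  rw [cross_comm, h, neg_zero]

theorem exists_smul_of_cross {p q : Fin 2 → ℂ} (hp : p ≠ 0) (h : cross p q = 0) :
    ∃ r : ℂ, q = r • p := by
  simp only [cross] at h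
  have h' : p 0 ≠ 0 ∨ p 1 ≠ 0 := by
    by_contra hn
    push Not at hn
    exact hp (by ext i; fin_cases i <;> simp [hn])
  rcases h' with h' | h'
  · refine ⟨q 0 / p 0, ?_⟩
    ext i
    fin_cases i
    · simp; field_simp
    · simp; field_simp; linear_combination h
  · refine ⟨q 1 / p 1, ?_⟩
    ext i
    fin_cases i
    · simp; field_simp; linear_combination -h
    · simp; field_simp

/-- Two vectors parallel to the same nonzero vector are parallel. -/
theorem cross_eq_zero_trans {p q r : Fin 2 → ℂ} (hp : p ≠ 0) (h : cross p q = 0)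
    (h' : cross p r = 0) : cross q r = 0 := by
  obtain ⟨x, rfl⟩ := exists_smul_of_cross hp h
  obtain ⟨y, rfl⟩ := exists_smul_of_cross hp h'
  simp [cross]
  ring

theorem collinear_iff_triArea (P Q R : Fin 2 → ℂ) :
    Collinear ℂ {P, Q, R} ↔ triArea P Q R = 0 := by
  rw [triArea_eq_zero_iff, collinear_iff_of_mem (p₀ := P) (by simp)]
  simp only [Set.mem_insert_iff, Set.mem_singleton_iff, forall_eq_or_imp, forall_eq, vadd_eq_add]
  constructor
  · rintro ⟨v, -, ⟨r, hr⟩, s, hs⟩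
    rw [hr, hs]
    simp [cross]
    ring
  · intro h
    by_cases hQ : Q - P = 0
    · refine ⟨R - P, ⟨0, by simp⟩, ⟨0, ?_⟩, 1, by simp⟩
      rw [sub_eq_zero] at hQ
      simp [hQ]
    · obtain ⟨r, hr⟩ := exists_smul_of_cross hQ h
      refine ⟨Q - P, ⟨0, by simp⟩, ⟨1, by simp⟩, r, ?_⟩
      rw [← hr]
      simp

namespace Drawing

open Triangulation

variable {V : Type u} [Fintype V] [DecidableEq V] {T : Triangulation V} {ρ : Drawing T}

theorem mem_nondegenerate {a b c : V} : {a, b, c} ∈ ρ.nondegenerate ↔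
    {a, b, c} ∈ triangles T.cx ∧ triArea (ρ.toFun a) (ρ.toFun b) (ρ.toFun c) ≠ 0 := by
  have h : ρ.toFun '' (({a, b, c} : Finset V) : Set V) =
      {ρ.toFun a, ρ.toFun b, ρ.toFun c} := by
    simp [Set.image_insert_eq]
  classical
  rw [nondegenerate, Finset.mem_filter, h, collinear_iff_triArea]

theorem nondegenerate_subset (ρ : Drawing T) : ρ.nondegenerate ⊆ triangles T.cx := by
  classical
  exact Finset.filter_subset _ _

theorem area_eq_zero {t : Finset V} (ht : t ∈ triangles T.cx) (h : t ∉ ρ.nondegenerate) :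
    ρ.area t = 0 := by
  obtain ⟨a, b, c, hp, rfl⟩ := exists_pos ht
  rw [area_eq ρ hp]
  by_contra hne
  exact h (mem_nondegenerate.2 ⟨ht, hne⟩)

/-- A set of triangles has total area zero if every directed edge of its boundary is drawn on a
line through `o`. -/
theorem sum_area_eq_zero (ρ : Drawing T) {I : Finset (Finset V)} (hI : I ⊆ triangles T.cx)
    (o : Fin 2 → ℂ)
    (h : ∀ a b c, T.pos a b c → {a, b, c} ∈ I → cross (ρ.toFun a - o) (ρ.toFun b - o) ≠ 0 →
      ∃ d, T.pos b a d ∧ {b, a, d} ∈ I) :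
    ∑ t ∈ I, ρ.area t = 0 := by
  classical
  let g : V × V → ℂ := fun d => 1 / 2 * cross (ρ.toFun d.1 - o) (ρ.toFun d.2 - o)
  let P : Finset (V × V × V) := Finset.univ.filter fun x =>
    T.pos x.1 x.2.1 x.2.2 ∧ {x.1, x.2.1, x.2.2} ∈ I
  have hP : ∀ a b c, (a, b, c) ∈ P ↔ T.pos a b c ∧ {a, b, c} ∈ I := by
    intro a b c
    simp [P]
  have hrotI : ∀ a b c : V, ({b, c, a} : Finset V) = {a, b, c} := by
    intro a b c
    grind
  have hrotP : ∀ a b c, (a, b, c) ∈ P ↔ (b, c, a) ∈ P := by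
    intro a b c
    rw [hP, hP, hrotI a b c]
    exact and_congr_left fun _ => ⟨T.pos_rotate _ _ _, pos_rotate'⟩
  -- Each triangle occurs in `P` once for each of its three rotations.
  have hsum : ∑ x ∈ P, ρ.area {x.1, x.2.1, x.2.2} = 3 * ∑ t ∈ I, ρ.area t := by
    rw [Finset.mul_sum, ← Finset.sum_fiberwise_of_maps_to
      (s := P) (t := I) (g := fun x => {x.1, x.2.1, x.2.2})
      (fun x hx => ((hP _ _ _).1 hx).2)]
    refine Finset.sum_congr rfl fun t ht => ?_
    obtain ⟨a, b, c, hp, rfl⟩ := exists_pos (hI ht)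
    have n1 := pos_ne hp
    have n2 := pos_ne₂ hp
    have n3 := pos_ne₃ hp
    have hfib : (P.filter fun x => ({x.1, x.2.1, x.2.2} : Finset V) = {a, b, c}) =
        {(a, b, c), (b, c, a), (c, a, b)} := by
      ext ⟨x, y, z⟩
      rw [Finset.mem_filter, hP]
      simp only [Finset.mem_insert, Finset.mem_singleton, Prod.mk.injEq]
      constructor
      · rintro ⟨⟨hpos, -⟩, he⟩
        have hx : x ∈ ({a, b, c} : Finset V) := he ▸ by simp
        have hy : y ∈ ({a, b, c} : Finset V) := he ▸ by simp
        have hz : z ∈ ({a, b, c} : Finset V) := he ▸ by simp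
        have m1 := pos_ne hpos
        have m2 := pos_ne₂ hpos
        have m3 := pos_ne₃ hpos
        have q1 := pos_asymm hp
        have q2 := pos_rotate' hpos
        have q3 := T.pos_rotate _ _ _ hpos
        simp only [Finset.mem_insert, Finset.mem_singleton] at hx hy hz
        clear he hP hrotP hrotI h
        rcases hx with rfl | rfl | rfl <;> rcases hy with rfl | rfl | rfl <;>
          rcases hz with rfl | rfl | rfl <;> simp_all
      · rintro (⟨rfl, rfl, rfl⟩ | ⟨rfl, rfl, rfl⟩ | ⟨rfl, rfl, rfl⟩)
        · exact ⟨⟨hp, ht⟩, rfl⟩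
        · exact ⟨⟨T.pos_rotate _ _ _ hp, by rwa [hrotI]⟩, hrotI _ _ _⟩
        · exact ⟨⟨pos_rotate' hp, by rwa [← hrotI]⟩, (hrotI _ _ _).symm⟩
    rw [Finset.sum_congr rfl fun x hx => by rw [(Finset.mem_filter.1 hx).2], Finset.sum_const,
      hfib, Finset.card_eq_three.2 ⟨_, _, _, by simp [n1], by simp [n3.symm], by simp [n2], rfl⟩]
    simp
  have hsplit : ∑ x ∈ P, ρ.area {x.1, x.2.1, x.2.2} = 3 * ∑ x ∈ P, g (x.1, x.2.1) := by
    have h1 : ∑ x ∈ P, g (x.2.1, x.2.2) = ∑ x ∈ P, g (x.1, x.2.1) := by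
      refine Finset.sum_nbij' (fun x => (x.2.1, x.2.2, x.1)) (fun x => (x.2.2, x.1, x.2.1))
        ?_ ?_ ?_ ?_ ?_
      · exact fun x hx => (hrotP _ _ _).1 hx
      · exact fun x hx => (hrotP _ _ _).2 hx
      all_goals exact fun x hx => rfl
    have h2 : ∑ x ∈ P, g (x.2.2, x.1) = ∑ x ∈ P, g (x.2.1, x.2.2) := by
      refine Finset.sum_nbij' (fun x => (x.2.1, x.2.2, x.1)) (fun x => (x.2.2, x.1, x.2.1))
        ?_ ?_ ?_ ?_ ?_
      · exact fun x hx => (hrotP _ _ _).1 hx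
      · exact fun x hx => (hrotP _ _ _).2 hx
      all_goals exact fun x hx => rfl
    have h3 : ∀ x ∈ P, ρ.area {x.1, x.2.1, x.2.2} =
        g (x.1, x.2.1) + g (x.2.1, x.2.2) + g (x.2.2, x.1) := by
      rintro ⟨a, b, c⟩ hx
      rw [area_eq ρ ((hP _ _ _).1 hx).1, triArea_eq_add o]
    rw [Finset.sum_congr rfl h3, Finset.sum_add_distrib, Finset.sum_add_distrib, h2, h1]
    ring
  -- By coherence a directed edge determines its triangle, so the sum over `P` is a sum over
  -- distinct directed edges.
  have hdart : ∑ x ∈ P, g (x.1, x.2.1) =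
      ∑ d ∈ (P.image fun x => (x.1, x.2.1)).filter fun d => g d ≠ 0, g d := by
    rw [Finset.sum_filter_ne_zero, Finset.sum_image]
    rintro ⟨a, b, c⟩ hx ⟨a', b', c'⟩ hx' he
    rw [Finset.mem_coe, hP] at hx hx'
    simp only [Prod.mk.injEq] at he
    obtain ⟨rfl, rfl⟩ := he
    rw [T.pos_coherent _ _ _ _ hx.1 hx'.1]
  have hg : ∀ a b, g (b, a) = -g (a, b) := fun a b => by
    simp only [g]
    rw [cross_comm]
    ring
  -- By hypothesis the directed edges with a nonzero term are closed under reversal, and reversal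
  -- changes the sign of the term. So the sum equals its own negative.
  have hanti : ∑ d ∈ (P.image fun x => (x.1, x.2.1)).filter fun d => g d ≠ 0, g d =
      ∑ d ∈ (P.image fun x => (x.1, x.2.1)).filter fun d => g d ≠ 0, -g d := by
    have hmaps : ∀ d ∈ (P.image fun x => (x.1, x.2.1)).filter fun d => g d ≠ 0,
        d.swap ∈ (P.image fun x => (x.1, x.2.1)).filter fun d => g d ≠ 0 := by
      rintro ⟨a, b⟩ hd
      rw [Finset.mem_filter, Finset.mem_image] at hd ⊢
      obtain ⟨⟨⟨a', b', c⟩, hx, he⟩, hne⟩ := hd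
      simp only [Prod.mk.injEq] at he
      obtain ⟨rfl, rfl⟩ := he
      rw [hP] at hx
      obtain ⟨d, hd1, hd2⟩ := h _ _ _ hx.1 hx.2 (fun h0 => hne (by simp only [g]; rw [h0, mul_zero]))
      refine ⟨⟨(b', a', d), (hP _ _ _).2 ⟨hd1, hd2⟩, rfl⟩, ?_⟩
      rw [Prod.swap_prod_mk, hg]
      exact neg_ne_zero.2 hne
    refine Finset.sum_nbij' Prod.swap Prod.swap hmaps hmaps (fun _ _ => Prod.swap_swap _)
      (fun _ _ => Prod.swap_swap _) ?_
    rintro ⟨a, b⟩ -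
    rw [Prod.swap_prod_mk, hg b a]
  rw [Finset.sum_neg_distrib, ← hdart] at hanti
  have h0 : ∑ x ∈ P, g (x.1, x.2.1) = 0 := self_eq_neg.1 hanti
  rw [hsum, h0, mul_zero] at hsplit
  simpa using hsplit

/-! ### Consequences of the absence of zero sums -/

/-- Degenerate triangles contribute no area, so the nondegenerate members of `I` already sum to zero
and there can be none. -/
theorem NoZeroSum.not_mem_of_sum (hρ : ρ.NoZeroSum) {I : Finset (Finset V)}
    (hI : I ⊆ triangles T.cx) (h : ∑ t ∈ I, ρ.area t = 0) : ∀ t ∈ I, t ∉ ρ.nondegenerate := by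
  intro t ht hn
  refine hρ (I ∩ ρ.nondegenerate) Finset.inter_subset_right
    ⟨t, Finset.mem_inter.2 ⟨ht, hn⟩⟩ ?_
  rw [← h]
  refine Finset.sum_subset Finset.inter_subset_left fun s hs hs' => ?_
  exact area_eq_zero (hI hs) fun h => hs' (Finset.mem_inter.2 ⟨hs, h⟩)

/-- A 3-cycle with an elastic edge contains no nondegenerate triangle. -/
theorem NoZeroSum.not_isInside (hρ : ρ.NoZeroSum) {x y z : V} (hxy : ρ.toFun x = ρ.toFun y)
    {t : Finset V} (ht : t ∈ ρ.nondegenerate) : ¬ T.IsInside {x, y, z} t := by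
  classical
  intro hin
  refine hρ.not_mem_of_sum (I := (triangles T.cx).filter fun t => T.IsInside {x, y, z} t)
    (Finset.filter_subset _ _) ?_ t (Finset.mem_filter.2 ⟨hin.1, hin⟩) ht
  -- Seen from the common image of `x` and `y`, every edge of the 3-cycle contributes zero, since it
  -- has an end drawn there. Any other edge of an inside triangle has inside triangles on both
  -- sides.
  refine sum_area_eq_zero ρ (Finset.filter_subset _ _) (ρ.toFun x) ?_
  intro a b c hp hI hne
  rw [Finset.mem_filter] at hI
  have hnS : ¬ ({a, b} : Finset V) ⊆ {x, y, z} := by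
    intro hs
    have ha := hs (show a ∈ _ by simp)
    have hb := hs (show b ∈ _ by simp)
    simp only [Finset.mem_insert, Finset.mem_singleton] at ha hb
    have h0 : ∀ u, u = x ∨ u = y ∨ u = z → ρ.toFun u - ρ.toFun x = 0 ∨ u = z := by
      rintro u (rfl | rfl | rfl)
      · exact Or.inl (sub_self _)
      · exact Or.inl (by rw [hxy, sub_self])
      · exact Or.inr rfl
    rcases h0 a ha with h1 | rfl
    · exact hne (by rw [h1, zero_cross])
    · rcases h0 b hb with h2 | rfl
      · exact hne (by rw [h2, cross_zero])
      · exact pos_ne hp rfl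
  have hE := adj_isEdge (pos_adj hp)
  have hba : T.IsDart b a := by
    by_contra hn
    exact hI.2.2 ⟨_, .refl, {a, b}, isBoundaryEdge_of_dart ⟨c, hp⟩ hn, by grind, hnS⟩
  obtain ⟨d, hd⟩ := hba
  have htri := T.pos_triangle _ _ _ hd
  refine ⟨d, hd, Finset.mem_filter.2 ⟨htri, CrossAdj.isInside ?_ hI.2⟩⟩
  exact ⟨hI.1, htri, {a, b}, hE, by grind, by grind, hnS⟩

/-- The corners are drawn at the vertices of a nondegenerate parallelogram. -/
theorem NoZeroSum.cross_corner_ne_zero (hρ : ρ.NoZeroSum) (hne : ρ.nondegenerate.Nonempty) :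
    cross (ρ.toFun (T.corner 1) - ρ.toFun (T.corner 0))
      (ρ.toFun (T.corner 3) - ρ.toFun (T.corner 0)) ≠ 0 := by
  intro h0
  obtain ⟨t, ht⟩ := hne
  refine hρ.not_mem_of_sum (Finset.Subset.refl _) ?_ t (ρ.nondegenerate_subset ht) ht
  -- Seen from the first corner, two sides of the parallelogram contribute zero, and the terms of
  -- the other two are multiples of the determinant assumed to vanish.
  refine sum_area_eq_zero ρ (Finset.Subset.refl _) (ρ.toFun (T.corner 0)) ?_
  intro a b c hp hI hne
  by_contra hno
  push Not at hno
  have hba : ¬ T.IsDart b a := fun ⟨d, hd⟩ => hno d hd (T.pos_triangle _ _ _ hd)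
  obtain ⟨i, rfl, rfl⟩ := exists_corner_of_dart ⟨c, hp⟩ hba
  have hpar := ρ.parallelogram
  have h2 : ρ.toFun (T.corner 2) - ρ.toFun (T.corner 0) =
      (ρ.toFun (T.corner 1) - ρ.toFun (T.corner 0)) +
        (ρ.toFun (T.corner 3) - ρ.toFun (T.corner 0)) := by
    have : ρ.toFun (T.corner 2) =
        ρ.toFun (T.corner 1) + ρ.toFun (T.corner 3) - ρ.toFun (T.corner 0) := by
      rw [← hpar]; abel
    rw [this]; abel
  apply hne
  fin_cases i
  · simp [zero_cross]
  · change cross (ρ.toFun (T.corner 1) - _) (ρ.toFun (T.corner 2) - _) = 0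
    rw [h2]
    simp only [cross, Pi.add_apply, Pi.sub_apply] at h0 ⊢
    linear_combination h0
  · change cross (ρ.toFun (T.corner 2) - _) (ρ.toFun (T.corner 3) - _) = 0
    rw [h2]
    simp only [cross, Pi.add_apply, Pi.sub_apply] at h0 ⊢
    linear_combination h0
  · change cross (ρ.toFun (T.corner 3) - _) (ρ.toFun (T.corner 0) - _) = 0
    rw [sub_self, cross_zero]

/-- The determinant of the two sides is the same at every corner of a parallelogram. -/
theorem NoZeroSum.cross_corner_ne_zero_all (hρ : ρ.NoZeroSum) (hne : ρ.nondegenerate.Nonempty)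
    (i : Fin 4) : cross (ρ.toFun (T.corner (i + 1)) - ρ.toFun (T.corner i))
      (ρ.toFun (T.corner (i + 3)) - ρ.toFun (T.corner i)) ≠ 0 := by
  have h := hρ.cross_corner_ne_zero hne
  have hpar := ρ.parallelogram
  have h2 : ρ.toFun (T.corner 2) =
      ρ.toFun (T.corner 1) + ρ.toFun (T.corner 3) - ρ.toFun (T.corner 0) := by
    rw [← hpar]; abel
  intro h0
  apply h
  fin_cases i
  · exact h0
  · change cross (ρ.toFun (T.corner 2) - ρ.toFun (T.corner 1))
      (ρ.toFun (T.corner 0) - ρ.toFun (T.corner 1)) = 0 at h0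
    rw [h2] at h0
    simp only [cross, Pi.add_apply, Pi.sub_apply] at h0 ⊢
    linear_combination h0
  · change cross (ρ.toFun (T.corner 3) - ρ.toFun (T.corner 2))
      (ρ.toFun (T.corner 1) - ρ.toFun (T.corner 2)) = 0 at h0
    rw [h2] at h0
    simp only [cross, Pi.add_apply, Pi.sub_apply] at h0 ⊢
    linear_combination h0
  · change cross (ρ.toFun (T.corner 0) - ρ.toFun (T.corner 3))
      (ρ.toFun (T.corner 2) - ρ.toFun (T.corner 3)) = 0 at h0
    rw [h2] at h0
    simp only [cross, Pi.add_apply, Pi.sub_apply] at h0 ⊢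
    linear_combination h0

/-! ### The size of simple drawings -/

/-- An elastic boundary edge would flatten the parallelogram. An elastic interior edge cannot be
contracted, so it lies on a subdivision; simplicity requires a nondegenerate triangle inside, and
`NoZeroSum.not_isInside` forbids it. -/
theorem IsSimple.toFun_ne (hs : ρ.IsSimple) (hρ : ρ.NoZeroSum)
    (hne : ρ.nondegenerate.Nonempty) {x y : V} (hxy : (oneSkeleton T.cx).Adj x y) :
    ρ.toFun x ≠ ρ.toFun y := by
  intro he
  by_cases hb : IsBoundaryEdge T.cx {x, y}
  · have key : ∀ a b, T.IsDart a b → ¬ T.IsDart b a → ρ.toFun a ≠ ρ.toFun b := by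
      intro a b h1 h2 h3
      obtain ⟨i, rfl, rfl⟩ := exists_corner_of_dart h1 h2
      refine hρ.cross_corner_ne_zero_all hne i ?_
      rw [h3, sub_self, zero_cross]
    rcases adj_iff.1 hxy with h | h
    · exact key x y h (fun h' => not_isBoundaryEdge_of_darts h h' hb) he
    · exact key y x h (fun h' => not_isBoundaryEdge_of_darts h' h hb) he.symm
  · have hc : ¬ T.CanContract x y := fun h => hs.elastic ⟨x, y, ⟨adj_isEdge hxy, hb⟩, he, h⟩
    obtain ⟨z, hz⟩ := exists_subdivision hxy hc
    obtain ⟨t, ht, hin⟩ := hs.subdivision _ hz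
    exact hρ.not_isInside he ht hin

/-- If `vab` were the only nondegenerate triangle at `v`, the walk around the link from `b` forward
to `a` would use degenerate triangles only. Without elastic edges each of these keeps the next
neighbour on the line through `v` and `b`, so `a` would lie on it too. -/
theorem IsSimple.two_le_card_at_interior (hs : ρ.IsSimple) (hρ : ρ.NoZeroSum)
    (hne : ρ.nondegenerate.Nonempty) {v : V} (hv : ∀ i, v ≠ T.corner i) :
    2 ≤ (ρ.nondegenerate.filter fun t => v ∈ t).card := by
  obtain ⟨t, ht, hvt⟩ := hs.interior v (mem_interiorVertices.2 hv)
  by_contra hlt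
  have hone : (ρ.nondegenerate.filter fun t => v ∈ t).card ≤ 1 := by omega
  rw [Finset.card_le_one] at hone
  obtain ⟨a, b, hp, rfl⟩ := exists_pos_of_mem (ρ.nondegenerate_subset ht) hvt
  have hab : cross (ρ.toFun b - ρ.toFun v) (ρ.toFun a - ρ.toFun v) ≠ 0 := fun h =>
    (mem_nondegenerate.1 ht).2 (triArea_eq_zero_iff.2 (cross_eq_zero_symm h))
  refine hab (cyclic_link_induction (P := fun c =>
    cross (ρ.toFun b - ρ.toFun v) (ρ.toFun c - ρ.toFun v) = 0) hv (pos_adj₃ hp) (cross_self _)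
    ?_ (pos_adj hp))
  intro c d hcd hc
  -- The triangle following `a` is `vab` itself, but `a` is not on the line, so this case does not
  -- arise.
  by_cases hca : c = a
  · exact absurd (hca ▸ hc) hab
  have hdeg : {v, c, d} ∉ ρ.nondegenerate := by
    intro hn
    have h1 := hone {v, c, d} (Finset.mem_filter.2 ⟨hn, by simp⟩) {v, a, b}
      (Finset.mem_filter.2 ⟨ht, by simp⟩)
    have h2 : a ∈ ({v, c, d} : Finset V) := h1 ▸ by simp
    have h3 : c ∈ ({v, a, b} : Finset V) := h1 ▸ by simp
    have m1 := pos_ne hcd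
    have m2 := pos_ne hp
    have hcb : c = b := by grind
    have hda : a = d := by grind
    subst hcb hda
    exact pos_asymm hp (pos_rotate' hcd)
  have h0 : cross (ρ.toFun c - ρ.toFun v) (ρ.toFun d - ρ.toFun v) = 0 := by
    by_contra h
    exact hdeg (mem_nondegenerate.2 ⟨T.pos_triangle _ _ _ hcd, fun h' =>
      h (triArea_eq_zero_iff.1 h')⟩)
  refine cross_eq_zero_trans (sub_ne_zero.2 ?_) (cross_eq_zero_symm hc) h0
  exact hs.toFun_ne hρ hne (pos_adj hcd).symm

/-- If all triangles at a corner were degenerate, all its neighbours would lie on one line through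
it, including the two adjacent corners. -/
theorem IsSimple.one_le_card_at_corner (hs : ρ.IsSimple) (hρ : ρ.NoZeroSum)
    (hne : ρ.nondegenerate.Nonempty) (i : Fin 4) :
    1 ≤ (ρ.nondegenerate.filter fun t => T.corner i ∈ t).card := by
  by_contra hlt
  have hzero : (ρ.nondegenerate.filter fun t => T.corner i ∈ t) = ∅ := by
    rw [← Finset.card_eq_zero]; omega
  have hdeg : ∀ a b, T.pos (T.corner i) a b →
      cross (ρ.toFun a - ρ.toFun (T.corner i)) (ρ.toFun b - ρ.toFun (T.corner i)) = 0 := by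
    intro a b hp
    by_contra h
    have : {T.corner i, a, b} ∈ ρ.nondegenerate.filter fun t => T.corner i ∈ t :=
      Finset.mem_filter.2 ⟨mem_nondegenerate.2 ⟨T.pos_triangle _ _ _ hp, fun h' =>
        h (triArea_eq_zero_iff.1 h')⟩, by simp⟩
    rw [hzero] at this
    exact Finset.notMem_empty _ this
  have hadj : (oneSkeleton T.cx).Adj (T.corner i) (T.corner (i + 3)) := by
    have := (isDart_corner (T := T) (i + 3)).adj.symm
    have h4 : i + 3 + 1 = i := by
      clear this hdeg hzero hlt
      revert i
      decide
    rwa [h4] at this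
  refine hρ.cross_corner_ne_zero_all hne i (link_induction (P := fun c =>
    cross (ρ.toFun (T.corner (i + 1)) - ρ.toFun (T.corner i))
      (ρ.toFun c - ρ.toFun (T.corner i)) = 0) (isDart_corner i).adj (cross_self _) ?_ hadj)
  intro a b hp
  have h0 := hdeg a b hp
  have ha := sub_ne_zero.2 (hs.toFun_ne hρ hne (pos_adj hp).symm)
  have hb := sub_ne_zero.2 (hs.toFun_ne hρ hne (pos_adj₃ hp).symm)
  exact ⟨fun h => cross_eq_zero_trans ha (cross_eq_zero_symm h) h0,
    fun h => cross_eq_zero_trans hb (cross_eq_zero_symm h) (cross_eq_zero_symm h0)⟩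

/-- Incidences of vertices and nondegenerate triangles: at least two for each interior vertex, at
least one for each of the four corners, exactly three for each triangle. -/
theorem IsSimple.card_le (hs : ρ.IsSimple) (hρ : ρ.NoZeroSum)
    (hne : ρ.nondegenerate.Nonempty) :
    2 * T.interiorVertices.card + 4 ≤ 3 * ρ.nondegenerate.card := by
  have h := Finset.sum_card_bipartiteAbove_eq_sum_card_bipartiteBelow
    (fun (v : V) (t : Finset V) => v ∈ t) (s := Finset.univ) (t := ρ.nondegenerate)
  have h1 : ∀ t ∈ ρ.nondegenerate, (Finset.bipartiteBelow (fun (v : V) (t : Finset V) => v ∈ t)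
      Finset.univ t).card = 3 := by
    intro t ht
    rw [← (mem_triangles.1 (ρ.nondegenerate_subset ht)).2]
    congr 1
    ext v
    simp [Finset.bipartiteBelow]
  rw [Finset.sum_congr rfl h1, Finset.sum_const, smul_eq_mul,
    ← Finset.sum_sdiff (Finset.subset_univ T.interiorVertices)] at h
  have h2 : T.interiorVertices.card * 2 ≤ ∑ v ∈ T.interiorVertices,
      (Finset.bipartiteAbove (fun (v : V) (t : Finset V) => v ∈ t) ρ.nondegenerate v).card :=
    Finset.card_nsmul_le_sum (N := ℕ) _ _ _ fun v hv =>
      hs.two_le_card_at_interior hρ hne (mem_interiorVertices.1 hv)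
  have h3 : (Finset.univ \ T.interiorVertices).card * 1 ≤
      ∑ v ∈ Finset.univ \ T.interiorVertices,
      (Finset.bipartiteAbove (fun (v : V) (t : Finset V) => v ∈ t) ρ.nondegenerate v).card := by
    refine Finset.card_nsmul_le_sum (N := ℕ) _ _ _ fun v hv => ?_
    simp only [Finset.mem_sdiff, Finset.mem_univ, true_and, mem_interiorVertices] at hv
    push Not at hv
    obtain ⟨i, rfl⟩ := hv
    exact hs.one_le_card_at_corner hρ hne i
  have h4 := Finset.card_sdiff_add_card_eq_card (Finset.subset_univ T.interiorVertices)
  have h5 := T.card_interiorVertices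
  rw [Finset.card_univ] at h4
  omega

end Drawing

/-! ### Contraction of an edge -/

section Orientation

variable {V : Type u} [Fintype V] [DecidableEq V]

/-- In a coherently oriented complex the triangles at an edge are counted by the directions in
which the edge is traversed. -/
theorem card_trianglesAt_of_orientation {K : AbstractSimplicialComplex V} {pos : V → V → V → Prop}
    (htri : ∀ a b c, pos a b c → {a, b, c} ∈ triangles K)
    (hxor : ∀ a b c, {a, b, c} ∈ triangles K → Xor (pos a b c) (pos b a c))
    (hcoh : ∀ a b c d, pos a b c → pos a b d → c = d) {a b : V} (hab : a ≠ b) :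
    open Classical in (trianglesAt K {a, b}).card =
      (if ∃ c, pos a b c then 1 else 0) + (if ∃ c, pos b a c then 1 else 0) := by
  classical
  let A : V → V → Finset (Finset V) := fun a b =>
    (Finset.univ.filter fun c => pos a b c).image fun c => {a, b, c}
  have hA : ∀ a b, (A a b).card = if ∃ c, pos a b c then 1 else 0 := by
    intro a b
    split_ifs with h
    · obtain ⟨c, hc⟩ := h
      refine Finset.card_eq_one.2 ⟨{a, b, c}, ?_⟩
      ext t
      simp only [A, Finset.mem_image, Finset.mem_filter, Finset.mem_univ, true_and,
        Finset.mem_singleton]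
      constructor
      · rintro ⟨d, hd, rfl⟩
        rw [hcoh _ _ _ _ hc hd]
      · rintro rfl
        exact ⟨c, hc, rfl⟩
    · push Not at h
      simp [A, h]
  have hdisj : Disjoint (A a b) (A b a) := by
    rw [Finset.disjoint_left]
    intro t h1 h2
    simp only [A, Finset.mem_image, Finset.mem_filter, Finset.mem_univ, true_and] at h1 h2
    obtain ⟨c, hc, rfl⟩ := h1
    obtain ⟨d, hd, he⟩ := h2
    have hcd : c = d := by
      have h3 := (mem_triangles.1 (htri _ _ _ hc)).2
      have hca : c ≠ a ∧ c ≠ b := by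
        have h4 := Finset.card_le_two (a := a) (b := b)
        constructor
        · rintro rfl
          rw [Finset.pair_comm b c, Finset.insert_idem] at h3
          omega
        · rintro rfl
          rw [Finset.pair_eq_singleton] at h3
          omega
      have : c ∈ ({b, a, d} : Finset V) := he ▸ by simp
      simp only [Finset.mem_insert, Finset.mem_singleton, hca.1, hca.2, false_or] at this
      exact this
    subst hcd
    rcases hxor _ _ _ (htri _ _ _ hc) with h | h
    · exact h.2 hd
    · exact h.2 hc
  have hunion : trianglesAt K {a, b} = A a b ∪ A b a := by
    ext t
    simp only [mem_trianglesAt, Finset.mem_union, A, Finset.mem_image, Finset.mem_filter,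
      Finset.mem_univ, true_and]
    constructor
    · rintro ⟨ht, hs⟩
      obtain ⟨c, hc⟩ := Finset.card_eq_one.1 (show (t \ {a, b}).card = 1 by
        rw [Finset.card_sdiff_of_subset hs, (mem_triangles.1 ht).2, Finset.card_pair hab])
      have htc : t = {a, b, c} := by
        rw [← Finset.union_sdiff_of_subset hs, hc, Finset.insert_union, Finset.singleton_union]
      rcases hxor a b c (htc ▸ ht) with h | h
      · exact Or.inl ⟨c, h.1, htc.symm⟩
      · exact Or.inr ⟨c, h.1, by rw [Finset.insert_comm, htc]⟩
    · rintro (⟨c, hc, rfl⟩ | ⟨c, hc, rfl⟩)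
      · exact ⟨htri _ _ _ hc, by grind⟩
      · exact ⟨htri _ _ _ hc, by grind⟩
  rw [hunion, Finset.card_union_of_disjoint hdisj, hA, hA]

end Orientation

namespace Triangulation

variable {V : Type u} [DecidableEq V]

/-- The map of the vertices that renames `y` as `x`. -/
def contractMap {x y : V} (hxy : x ≠ y) (v : V) : {u : V // u ≠ y} :=
  if h : v = y then ⟨x, hxy⟩ else ⟨v, h⟩

theorem contractMap_val {x y : V} (hxy : x ≠ y) (v : V) :
    (contractMap hxy v).1 = if v = y then x else v := by
  unfold contractMap
  split_ifs <;> rfl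

theorem contractMap_coe {x y : V} (hxy : x ≠ y) (v : {u : V // u ≠ y}) :
    contractMap hxy v.1 = v := by
  simp [contractMap, v.2]

theorem contractMap_right {x y : V} (hxy : x ≠ y) : contractMap hxy y = ⟨x, hxy⟩ := by
  simp [contractMap]

theorem contractMap_left {x y : V} (hxy : x ≠ y) : contractMap hxy x = ⟨x, hxy⟩ := by
  simp [contractMap, hxy]

theorem contractMap_eq_iff {x y : V} (hxy : x ≠ y) {a b : V} :
    contractMap hxy a = contractMap hxy b ↔ a = b ∨ (a = x ∧ b = y) ∨ (a = y ∧ b = x) := by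
  rw [Subtype.ext_iff, contractMap_val, contractMap_val]
  split_ifs with h1 h2 h2
  · simp [h1, h2]
  · subst h1
    constructor
    · rintro rfl
      exact Or.inr (Or.inr ⟨rfl, rfl⟩)
    · rintro (h | ⟨-, h⟩ | ⟨-, h⟩)
      · exact absurd h.symm h2
      · exact absurd h h2
      · exact h.symm
  · subst h2
    constructor
    · rintro rfl
      exact Or.inr (Or.inl ⟨rfl, rfl⟩)
    · rintro (h | ⟨h, -⟩ | ⟨h, -⟩)
      · exact absurd h h1
      · exact h
      · exact absurd h h1
  · simp [h1, h2]

theorem contractMap_injOn {x y : V} (hxy : x ≠ y) {t : Finset V} (h : ¬ {x, y} ⊆ t) :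
    Set.InjOn (contractMap hxy) t := by
  intro a ha b hb hab
  rcases (contractMap_eq_iff hxy).1 hab with h1 | ⟨rfl, rfl⟩ | ⟨rfl, rfl⟩
  · exact h1
  · exact absurd (by grind) h
  · exact absurd (by grind) h

variable [Fintype V]

/-- The edge `xy` is an interior edge that can be contracted to `x`, and `y` is not a corner. -/
structure IsContractible (T : Triangulation V) (x y : V) : Prop where
  dart : T.IsDart x y
  dart' : T.IsDart y x
  interior : ∀ i, y ≠ T.corner i
  canContract : T.CanContract x y

/-- The complex obtained by contracting an edge. -/
def contractCx (T : Triangulation V) {x y : V} (hxy : x ≠ y) :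
    AbstractSimplicialComplex {u : V // u ≠ y} :=
  (T.cx.toPreAbstractSimplicialComplex.map (contractMap hxy)).toAbstractSimplicialComplex _
    fun v => ⟨{v.1}, T.cx.singleton_mem v.1, by simp [contractMap_coe]⟩

theorem mem_contractCx {T : Triangulation V} {x y : V} {hxy : x ≠ y}
    {s : Finset {u : V // u ≠ y}} :
    s ∈ (T.contractCx hxy).faces ↔ ∃ s' ∈ T.cx.faces, s'.image (contractMap hxy) = s :=
  Iff.rfl

theorem image_mem_contractCx {T : Triangulation V} {x y : V} (hxy : x ≠ y) {s : Finset V}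
    (hs : s ∈ T.cx.faces) : s.image (contractMap hxy) ∈ (T.contractCx hxy).faces :=
  ⟨s, hs, rfl⟩

variable {T : Triangulation V} {x y : V} (hxy : x ≠ y)

/-- The cyclic order of the vertices in the triangles of the contracted complex. -/
def contractPos (T : Triangulation V) {x y : V} (hxy : x ≠ y) (a b c : {u : V // u ≠ y}) : Prop :=
  ∃ a' b' c', T.pos a' b' c' ∧ ¬ {x, y} ⊆ ({a', b', c'} : Finset V) ∧
    contractMap hxy a' = a ∧ contractMap hxy b' = b ∧ contractMap hxy c' = c

theorem mem_triangles_contractCx {t : Finset {u : V // u ≠ y}} :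
    t ∈ triangles (T.contractCx hxy) ↔
      ∃ s ∈ triangles T.cx, ¬ {x, y} ⊆ s ∧ s.image (contractMap hxy) = t := by
  rw [mem_triangles, mem_contractCx]
  constructor
  · rintro ⟨⟨s, hs, rfl⟩, hc⟩
    have h3 := T.isDisk.card_le s hs
    have h4 : (s.image (contractMap hxy)).card ≤ s.card := Finset.card_image_le
    have h5 : s.card = 3 := by omega
    refine ⟨s, mem_triangles.2 ⟨hs, h5⟩, fun h => ?_, rfl⟩
    have hinj := Finset.card_image_iff.1 (hc.trans h5.symm)
    exact hxy (hinj (h (by simp)) (h (by simp))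
      ((contractMap_eq_iff hxy).2 (Or.inr (Or.inl ⟨rfl, rfl⟩))))
  · rintro ⟨s, hs, h, rfl⟩
    rw [mem_triangles] at hs
    exact ⟨⟨s, hs.1, rfl⟩, by rw [Finset.card_image_of_injOn (contractMap_injOn hxy h), hs.2]⟩

/-- Identified faces have at most two vertices, so distinct surviving triangles keep distinct
images. -/
theorem CanContract.image_injOn (h : T.CanContract x y) {s s' : Finset V}
    (hs : s ∈ triangles T.cx) (hs' : s' ∈ triangles T.cx) (hn : ¬ {x, y} ⊆ s)
    (hn' : ¬ {x, y} ⊆ s') (he : s.image (contractMap hxy) = s'.image (contractMap hxy)) :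
    s = s' := by
  rw [mem_triangles] at hs hs'
  have he' := congrArg (Finset.image Subtype.val) he
  simp only [Finset.image_image, Function.comp_def, contractMap_val] at he'
  have key : ∀ s s' : Finset V, s.card = 3 → ¬ T.Identified x y s s' := by
    intro s s' hc hid
    rcases identified_iff.1 hid with ⟨h3, -⟩ | ⟨z', -, h3, -⟩
    · rw [h3] at hc; simp at hc
    · rw [h3] at hc; have := Finset.card_le_two (a := z') (b := x); omega
  rcases h s hs.1 s' hs'.1 hn hn' he' with h | h | h
  · exact h
  · exact absurd h (key _ _ hs.2)
  · exact absurd h (key _ _ hs'.2)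

theorem contractPos_of_pos {a b c : V} (h : T.pos a b c)
    (hn : ¬ {x, y} ⊆ ({a, b, c} : Finset V)) :
    T.contractPos hxy (contractMap hxy a) (contractMap hxy b) (contractMap hxy c) :=
  ⟨a, b, c, h, hn, rfl, rfl, rfl⟩

theorem contractPos_triangle (a b c : {u : V // u ≠ y}) (h : T.contractPos hxy a b c) :
    {a, b, c} ∈ triangles (T.contractCx hxy) := by
  obtain ⟨a', b', c', hp, hn, rfl, rfl, rfl⟩ := h
  exact (mem_triangles_contractCx hxy).2 ⟨_, T.pos_triangle _ _ _ hp, hn, by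
    simp [Finset.image_insert]⟩

theorem contractPos_rotate (a b c : {u : V // u ≠ y}) (h : T.contractPos hxy a b c) :
    T.contractPos hxy b c a := by
  obtain ⟨a', b', c', hp, hn, ha, hb, hc⟩ := h
  refine ⟨b', c', a', T.pos_rotate _ _ _ hp, ?_, hb, hc, ha⟩
  rwa [show ({b', c', a'} : Finset V) = {a', b', c'} by grind]

theorem IsContractible.contractPos_xor (h : T.IsContractible x y) (a b c : {u : V // u ≠ y})
    (ht : {a, b, c} ∈ triangles (T.contractCx hxy)) :
    Xor (T.contractPos hxy a b c) (T.contractPos hxy b a c) := by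
  have hnot : ¬ (T.contractPos hxy a b c ∧ T.contractPos hxy b a c) := by
    rintro ⟨⟨a₁, b₁, c₁, hp, hn, rfl, rfl, rfl⟩, ⟨b₂, a₂, c₂, hp', hn', hb, ha, hc⟩⟩
    have he := h.canContract.image_injOn hxy (T.pos_triangle _ _ _ hp')
      (T.pos_triangle _ _ _ hp) hn' hn (by
        simp only [Finset.image_insert, Finset.image_singleton, ha, hb, hc]
        exact Finset.insert_comm _ _ _)
    have hinj := contractMap_injOn hxy hn
    have e1 : a₂ = a₁ := hinj (by rw [← he]; simp) (by simp) ha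
    have e2 : b₂ = b₁ := hinj (by rw [← he]; simp) (by simp) hb
    have e3 : c₂ = c₁ := hinj (by rw [← he]; simp) (by simp) hc
    subst e1 e2 e3
    exact pos_asymm hp hp'
  have hor : T.contractPos hxy a b c ∨ T.contractPos hxy b a c := by
    have hcard := (mem_triangles.1 ht).2
    obtain ⟨s, hs, hn, he⟩ := (mem_triangles_contractCx hxy).1 ht
    have hlift : ∀ u ∈ ({a, b, c} : Finset _), ∃ u' ∈ s, contractMap hxy u' = u := by
      intro u hu
      rw [← he] at hu
      simpa using hu
    obtain ⟨a', ha, rfl⟩ := hlift a (by simp)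
    obtain ⟨b', hb, rfl⟩ := hlift b (by simp)
    obtain ⟨c', hc, rfl⟩ := hlift c (by simp)
    have hsub : ({a', b', c'} : Finset V) ⊆ s := by grind
    have hs' : ({a', b', c'} : Finset V) = s := by
      refine Finset.eq_of_subset_of_card_le hsub ?_
      rw [(mem_triangles.1 hs).2, ← hcard]
      have := Finset.card_image_le (s := ({a', b', c'} : Finset V)) (f := contractMap hxy)
      simpa [Finset.image_insert] using this
    subst hs'
    rcases pos_or hs with h | h
    · exact Or.inl (contractPos_of_pos hxy h hn)
    · exact Or.inr (contractPos_of_pos hxy h (by rwa [Finset.insert_comm]))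
  rcases hor with h1 | h1
  · exact Or.inl ⟨h1, fun h2 => hnot ⟨h1, h2⟩⟩
  · exact Or.inr ⟨h1, fun h2 => hnot ⟨h2, h1⟩⟩

/-- A vertex joined to both ends of a contractible edge forms a triangle with it. -/
theorem IsContractible.pos_or (h : T.IsContractible x y) {z : V}
    (hx : (oneSkeleton T.cx).Adj x z) (hy : (oneSkeleton T.cx).Adj y z) :
    T.pos x y z ∨ T.pos y x z :=
  Triangulation.pos_or (h.canContract.triangle h.dart.adj hx hy)

theorem IsContractible.contractPos_coherent (h : T.IsContractible x y)
    (a b c d : {u : V // u ≠ y}) (hc : T.contractPos hxy a b c) (hd : T.contractPos hxy a b d) :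
    c = d := by
  obtain ⟨a₁, b₁, c₁, hp, hn, rfl, rfl, rfl⟩ := hc
  obtain ⟨a₂, b₂, d₂, hp', hn', ha, hb, rfl⟩ := hd
  -- Coherence can fail only where a dart at `x` merges with one at `y`. Their other end is then a
  -- common neighbour and forms a triangle with `xy`. By coherence this triangle is one of the two
  -- given ones, yet it does not survive the contraction.
  have first : ∀ b c d, T.pos x b c → T.pos y b d → c ≠ y → d ≠ x → False := by
    intro b c d h1 h2 h3 h4
    rcases h.pos_or (pos_adj h1) (pos_adj h2) with h5 | h5
    · exact h4 (T.pos_coherent _ _ _ _ h2 (T.pos_rotate _ _ _ h5))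
    · exact h3 (T.pos_coherent _ _ _ _ h1 (T.pos_rotate _ _ _ h5))
  have second : ∀ a c d, T.pos a x c → T.pos a y d → c ≠ y → d ≠ x → False := by
    intro a c d h1 h2 h3 h4
    rcases h.pos_or (pos_adj h1).symm (pos_adj h2).symm with h5 | h5
    · exact h3 (T.pos_coherent _ _ _ _ h1 (pos_rotate' h5))
    · exact h4 (T.pos_coherent _ _ _ _ h2 (pos_rotate' h5))
  have n1 := pos_ne hp
  have n2 := pos_ne hp'
  rcases (contractMap_eq_iff hxy).1 ha with rfl | ⟨rfl, rfl⟩ | ⟨rfl, rfl⟩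
  · rcases (contractMap_eq_iff hxy).1 hb with rfl | ⟨rfl, rfl⟩ | ⟨rfl, rfl⟩
    · rw [T.pos_coherent _ _ _ _ hp hp']
    · exact (second _ _ _ hp' hp (fun e => hn' (by grind)) (fun e => hn (by grind))).elim
    · exact (second _ _ _ hp hp' (fun e => hn (by grind)) (fun e => hn' (by grind))).elim
  · rcases (contractMap_eq_iff hxy).1 hb with rfl | ⟨rfl, rfl⟩ | ⟨rfl, rfl⟩
    · exact (first _ _ _ hp' hp (fun e => hn' (by grind)) (fun e => hn (by grind))).elim
    · exact absurd rfl n1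
    · exact absurd (by grind) hn
  · rcases (contractMap_eq_iff hxy).1 hb with rfl | ⟨rfl, rfl⟩ | ⟨rfl, rfl⟩
    · exact (first _ _ _ hp hp' (fun e => hn (by grind)) (fun e => hn' (by grind))).elim
    · exact absurd (by grind) hn
    · exact absurd rfl n1

/-- If a lift of the dart has a reverse, the triangle of that reverse contains `xy` and collapses,
merging the dart with another side of this triangle. The far side of that edge either supplies the
forbidden reverse dart or is the boundary. -/
theorem exists_corner_of_contractPos {a b : {u : V // u ≠ y}}
    (hab : ∃ c, T.contractPos hxy a b c) (hba : ¬ ∃ c, T.contractPos hxy b a c) :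
    ∃ i, a = contractMap hxy (T.corner i) ∧ b = contractMap hxy (T.corner (i + 1)) := by
  obtain ⟨_, a₁, b₁, c₁, hp, hn, rfl, rfl, rfl⟩ := hab
  by_cases hd : T.IsDart b₁ a₁
  swap
  · obtain ⟨i, rfl, rfl⟩ := exists_corner_of_dart ⟨c₁, hp⟩ hd
    exact ⟨i, rfl, rfl⟩
  obtain ⟨d, hd⟩ := hd
  have hsub : {x, y} ⊆ ({b₁, a₁, d} : Finset V) := by
    by_contra hs
    exact hba ⟨_, contractPos_of_pos hxy hd hs⟩
  have n1 := pos_ne hp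
  have hpair : ∀ p q : V, contractMap hxy p = contractMap hxy q → p ≠ q →
      ∀ s : Finset V, {x, y} ⊆ s ↔ p ∈ s ∧ q ∈ s := by
    intro p q hpq hne s
    rcases (contractMap_eq_iff hxy).1 hpq with rfl | ⟨rfl, rfl⟩ | ⟨rfl, rfl⟩
    · exact absurd rfl hne
    · rw [Finset.insert_subset_iff, Finset.singleton_subset_iff]
    · rw [Finset.insert_subset_iff, Finset.singleton_subset_iff, and_comm]
  have hxd := hsub (show x ∈ _ by simp)
  have hyd := hsub (show y ∈ _ by simp)
  have hnn : ¬ (x ∈ ({a₁, b₁, c₁} : Finset V) ∧ y ∈ ({a₁, b₁, c₁} : Finset V)) :=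
    fun h => hn (by grind)
  have hcases : (contractMap hxy a₁ = contractMap hxy d ∧ a₁ ≠ d) ∨
      (contractMap hxy b₁ = contractMap hxy d ∧ b₁ ≠ d) := by
    simp only [contractMap_eq_iff]
    have := pos_ne₂ hd
    have := pos_ne₃ hd
    clear hpair hba hp hd
    grind
  rcases hcases with ⟨he, hne⟩ | ⟨he, hne⟩
  · by_cases hq : T.IsDart b₁ d
    · obtain ⟨e, hq⟩ := hq
      have hea : a₁ ≠ e := by
        rintro rfl
        exact pos_asymm (pos_rotate' hd) hq
      refine absurd ⟨contractMap hxy e, ?_⟩ hba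
      rw [he]
      refine contractPos_of_pos hxy hq fun hs => ?_
      have := ((hpair _ _ he hne _).1 hs).1
      grind
    · obtain ⟨i, h1, h2⟩ := exists_corner_of_dart ⟨_, pos_rotate' hd⟩ hq
      exact ⟨i, by rw [he, h1], by rw [h2]⟩
  · by_cases hq : T.IsDart d a₁
    · obtain ⟨e, hq⟩ := hq
      have heb : b₁ ≠ e := by
        rintro rfl
        exact pos_asymm (T.pos_rotate _ _ _ hd) hq
      refine absurd ⟨contractMap hxy e, ?_⟩ hba
      rw [he]
      refine contractPos_of_pos hxy hq fun hs => ?_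
      have := ((hpair _ _ he hne _).1 hs).1
      grind
    · obtain ⟨i, h1, h2⟩ := exists_corner_of_dart ⟨_, T.pos_rotate _ _ _ hd⟩ hq
      exact ⟨i, by rw [h1], by rw [he, h2]⟩

/-- The triangle at a boundary edge collapses only when `y` is its third vertex and `x` one of the
two corners. Then the triangle across its side from `y` to the other corner replaces it; it exists
because `y` is interior. -/
theorem IsContractible.exists_contractPos_corner (h : T.IsContractible x y) (i : Fin 4) :
    ∃ c, T.contractPos hxy (contractMap hxy (T.corner i)) (contractMap hxy (T.corner (i + 1))) c := by
  obtain ⟨c, hc⟩ := isDart_corner (T := T) i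
  have n1 := h.interior i
  have n2 := h.interior (i + 1)
  by_cases hs : {x, y} ⊆ ({T.corner i, T.corner (i + 1), c} : Finset V)
  swap
  · exact ⟨_, contractPos_of_pos hxy hc hs⟩
  have hx := hs (show x ∈ _ by simp)
  have hy := hs (show y ∈ _ by simp)
  simp only [Finset.mem_insert, Finset.mem_singleton, n1, n2, false_or] at hx hy
  subst hy
  rcases hx with hx | hx | hx
  · have hd : T.IsDart (T.corner (i + 1)) y := ⟨_, T.pos_rotate _ _ _ hc⟩
    obtain ⟨e, he⟩ := hd.symm_of_interior' h.interior
    have hex : x ≠ e := by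
      rintro rfl
      rw [← hx] at hc
      exact pos_asymm (T.pos_rotate _ _ _ hc) he
    refine ⟨contractMap hxy e, ?_⟩
    rw [← hx, (contractMap_left hxy).trans (contractMap_right hxy).symm]
    refine contractPos_of_pos hxy he fun hs => ?_
    have := hs (show x ∈ _ by simp)
    have := T.corner_injective.ne (show i ≠ i + 1 by clear * -; revert i; decide)
    grind
  · have hd : T.IsDart y (T.corner i) := ⟨_, pos_rotate' hc⟩
    obtain ⟨e, he⟩ := hd.symm_of_interior h.interior
    have hex : x ≠ e := by
      rintro rfl
      rw [← hx] at hc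
      exact pos_asymm (pos_rotate' hc) he
    refine ⟨contractMap hxy e, ?_⟩
    rw [← hx, (contractMap_left hxy).trans (contractMap_right hxy).symm]
    refine contractPos_of_pos hxy he fun hs => ?_
    have := hs (show x ∈ _ by simp)
    have := T.corner_injective.ne (show i ≠ i + 1 by clear * -; revert i; decide)
    grind
  · exact absurd hx hxy

theorem IsContractible.not_exists_contractPos_corner (h : T.IsContractible x y) (i : Fin 4) :
    ¬ ∃ c, T.contractPos hxy (contractMap hxy (T.corner (i + 1)))
      (contractMap hxy (T.corner i)) c := by
  rintro ⟨_, q, p, c, hp, hn, hq, hp', -⟩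
  have n1 := h.interior i
  have n2 := h.interior (i + 1)
  have hno := not_isDart_corner (T := T) i
  have hadj := (isDart_corner (T := T) i).adj
  rcases (contractMap_eq_iff hxy).1 hq with rfl | ⟨-, h1⟩ | ⟨rfl, h1⟩
  · rcases (contractMap_eq_iff hxy).1 hp' with rfl | ⟨-, h2⟩ | ⟨rfl, h2⟩
    · exact hno ⟨c, hp⟩
    · exact n1 h2.symm
    · have hcx : c ≠ x := fun e => hn (by grind)
      rw [h2] at hadj hno
      rcases h.pos_or hadj (pos_adj hp).symm with h5 | h5
      · exact hno ⟨_, pos_rotate' h5⟩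
      · exact hcx (T.pos_coherent _ _ _ _ hp (pos_rotate' h5))
  · exact n2 h1.symm
  · rcases (contractMap_eq_iff hxy).1 hp' with rfl | ⟨-, h2⟩ | ⟨rfl, h2⟩
    · have hcx : c ≠ x := fun e => hn (by grind)
      rw [h1] at hadj hno
      rcases h.pos_or hadj.symm (pos_adj hp) with h5 | h5
      · exact hcx (T.pos_coherent _ _ _ _ hp (T.pos_rotate _ _ _ h5))
      · exact hno ⟨_, T.pos_rotate _ _ _ h5⟩
    · exact n1 h2.symm
    · exact pos_ne hp rfl

end Triangulation

/-! ### The contracted complex is a disk -/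

theorem ElementaryHomotopy.cons {V : Type u} [DecidableEq V] {K : AbstractSimplicialComplex V}
    {l l' : List V} (a : V)
    (h : Relation.EqvGen (ElementaryHomotopy K) l l') :
    Relation.EqvGen (ElementaryHomotopy K) (a :: l) (a :: l') := by
  induction h with
  | rel l l' h =>
    obtain ⟨p, q, u, v, w, hf, rfl, rfl⟩ := h
    exact .rel _ _ ⟨a :: p, q, u, v, w, hf, rfl, rfl⟩
  | refl => exact .refl _
  | symm _ _ _ ih => exact ih.symm
  | trans _ _ _ _ _ ih₁ ih₂ => exact ih₁.trans _ _ _ ih₂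

section Link

variable {V : Type u} [DecidableEq V] {K : AbstractSimplicialComplex V}

/-- The neighbours `a` and `b` of `v` are joined in the link of `v`. -/
def LinkReach (K : AbstractSimplicialComplex V) (v a b : V) : Prop :=
  ∃ (ha : (oneSkeleton K).Adj v a) (hb : (oneSkeleton K).Adj v b),
    (linkGraph K v).Reachable ⟨a, ha⟩ ⟨b, hb⟩

theorem LinkReach.refl {v a : V} (ha : (oneSkeleton K).Adj v a) : LinkReach K v a a :=
  ⟨ha, ha, SimpleGraph.Reachable.refl _⟩

theorem LinkReach.step {v a b c : V} (h : LinkReach K v a b) (hc : (oneSkeleton K).Adj v c)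
    (hf : {v, b, c} ∈ K.faces) : LinkReach K v a c := by
  obtain ⟨ha, hb, hr⟩ := h
  by_cases hbc : b = c
  · subst hbc
    exact ⟨ha, hb, hr⟩
  · refine ⟨ha, hc, hr.trans (SimpleGraph.Adj.reachable ⟨?_, hf⟩)⟩
    exact fun e => hbc (congrArg Subtype.val e)

theorem linkGraph_connected {v a : V} (ha : (oneSkeleton K).Adj v a)
    (h : ∀ b, (oneSkeleton K).Adj v b → LinkReach K v a b) : (linkGraph K v).Connected := by
  have : Nonempty {b : V // (oneSkeleton K).Adj v b} := ⟨⟨a, ha⟩⟩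
  refine ⟨fun b c => ?_⟩
  obtain ⟨_, _, hb⟩ := h b.1 b.2
  obtain ⟨_, _, hc⟩ := h c.1 c.2
  exact hb.symm.trans hc

end Link

namespace Triangulation

variable {V : Type u} [Fintype V] [DecidableEq V] {T : Triangulation V} {x y : V} (hxy : x ≠ y)

theorem exists_lift_pair {a b : {u : V // u ≠ y}} (h : {a, b} ∈ (T.contractCx hxy).faces) :
    ∃ a' b', {a', b'} ∈ T.cx.faces ∧ contractMap hxy a' = a ∧ contractMap hxy b' = b := by
  obtain ⟨s, hs, he⟩ := mem_contractCx.1 h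
  have hlift : ∀ u ∈ ({a, b} : Finset _), ∃ u' ∈ s, contractMap hxy u' = u := by
    intro u hu
    rw [← he] at hu
    simpa using hu
  obtain ⟨a', ha, rfl⟩ := hlift a (by simp)
  obtain ⟨b', hb, rfl⟩ := hlift b (by simp)
  exact ⟨a', b', face_mono _ hs (by grind) (by simp), rfl, rfl⟩

theorem pair_mem_contractCx {a b : V} (h : {a, b} ∈ T.cx.faces) :
    {contractMap hxy a, contractMap hxy b} ∈ (T.contractCx hxy).faces := by
  have := image_mem_contractCx hxy h
  simpa [Finset.image_insert] using this

theorem triple_mem_contractCx {a b c : V} (h : {a, b, c} ∈ T.cx.faces) :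
    {contractMap hxy a, contractMap hxy b, contractMap hxy c} ∈ (T.contractCx hxy).faces := by
  have := image_mem_contractCx hxy h
  simpa [Finset.image_insert] using this

theorem map_homotopy {l l' : List V} (h : Relation.EqvGen (ElementaryHomotopy T.cx) l l') :
    Relation.EqvGen (ElementaryHomotopy (T.contractCx hxy)) (l.map (contractMap hxy))
      (l'.map (contractMap hxy)) := by
  induction h with
  | rel l l' h =>
    obtain ⟨p, q, u, v, w, hf, rfl, rfl⟩ := h
    exact .rel _ _ ⟨p.map (contractMap hxy), q.map (contractMap hxy), contractMap hxy u,
      contractMap hxy v, contractMap hxy w, triple_mem_contractCx hxy hf, by simp, by simp⟩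
  | refl => exact .refl _
  | symm _ _ _ ih => exact ih.symm
  | trans _ _ _ _ _ ih₁ ih₂ => exact ih₁.trans _ _ _ ih₂

namespace IsContractible

theorem pair_mem_of_contractMap_eq (h : T.IsContractible x y) {a b : V}
    (hab : contractMap hxy a = contractMap hxy b) : {a, b} ∈ T.cx.faces := by
  rcases (contractMap_eq_iff hxy).1 hab with rfl | ⟨rfl, rfl⟩ | ⟨rfl, rfl⟩
  · simpa using T.cx.singleton_mem a
  · exact h.dart.adj.2
  · exact h.dart'.adj.2

/-- Edges lift one by one. Consecutive lifts end and start in the same fibre, so they are joined by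
a constant step or by the edge `xy`. Each such step only repeats a vertex in the image, which a
homotopy removes. -/
theorem exists_lift_path (h : T.IsContractible x y) (l : List {u : V // u ≠ y}) :
    ∀ a b : V, IsEdgePath (T.contractCx hxy) (contractMap hxy a :: l ++ [contractMap hxy b]) →
      ∃ m : List V, IsEdgePath T.cx (a :: m ++ [b]) ∧
        Relation.EqvGen (ElementaryHomotopy (T.contractCx hxy))
          ((a :: m ++ [b]).map (contractMap hxy))
          (contractMap hxy a :: l ++ [contractMap hxy b]) := by
  induction l with
  | nil =>
    intro a b hp
    simp only [IsEdgePath, List.cons_append, List.nil_append, List.isChain_cons_cons,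
      List.isChain_singleton, and_true] at hp
    obtain ⟨a₁, b₁, hf, ha, hb⟩ := exists_lift_pair hxy hp
    refine ⟨[a₁, b₁], ?_, ?_⟩
    · simp only [IsEdgePath, List.cons_append, List.nil_append, List.isChain_cons_cons,
        List.isChain_singleton, and_true]
      exact ⟨h.pair_mem_of_contractMap_eq hxy ha.symm, hf, h.pair_mem_of_contractMap_eq hxy hb⟩
    · simp only [List.cons_append, List.nil_append, List.map_cons, List.map_nil, ha, hb]
      refine .trans _ [contractMap hxy a, contractMap hxy b, contractMap hxy b] _
        (.rel _ _ ⟨[], [contractMap hxy b], _, contractMap hxy a, _, ?_, rfl, rfl⟩)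
        (.rel _ _ ⟨[], [], _, contractMap hxy b, _, ?_, rfl, rfl⟩)
      · simpa using hp
      · simpa using hp
  | cons c l ih =>
    intro a b hp
    simp only [IsEdgePath, List.cons_append, List.isChain_cons_cons] at hp
    obtain ⟨a₁, c₁, hf, ha, rfl⟩ := exists_lift_pair hxy hp.1
    obtain ⟨m, hm, hhom⟩ := ih c₁ b hp.2
    refine ⟨a₁ :: c₁ :: m, ?_, ?_⟩
    · simp only [IsEdgePath, List.cons_append, List.isChain_cons_cons]
      exact ⟨h.pair_mem_of_contractMap_eq hxy ha.symm, hf, hm⟩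
    · simp only [List.cons_append, List.map_cons, ha] at hhom ⊢
      refine .trans _ _ _ (ElementaryHomotopy.cons _ (ElementaryHomotopy.cons _ hhom)) ?_
      refine .rel _ _ ⟨[], l ++ [contractMap hxy b], contractMap hxy a, contractMap hxy a,
        contractMap hxy c₁, ?_, rfl, rfl⟩
      simpa using hp.1

/-- A collapsed triangle `xyz` becomes an edge of the image of the triangle on the other side of
`yz`, which exists because `y` is interior. This keeps the complex purely two-dimensional. -/
theorem exists_triangle_of_subset (h : T.IsContractible x y) {t : Finset V}
    (ht : t ∈ triangles T.cx) : ∃ t' ∈ triangles T.cx, ¬ {x, y} ⊆ t' ∧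
      t.image (contractMap hxy) ⊆ t'.image (contractMap hxy) := by
  by_cases hs : {x, y} ⊆ t
  swap
  · exact ⟨t, ht, hs, Finset.Subset.refl _⟩
  have hxy' := (contractMap_left hxy).trans (contractMap_right hxy).symm
  obtain ⟨z, hz, rfl⟩ := exists_pos_of_pair ht hxy (hs (by simp)) (hs (by simp))
  have himg : ∀ w, ({x, y, z} : Finset V).image (contractMap hxy) ⊆
      ({y, z, w} : Finset V).image (contractMap hxy) := by
    intro w
    simp only [Finset.image_insert, Finset.image_singleton, hxy']
    grind
  rcases hz with hz | hz
  · have hd : T.IsDart y z := ⟨_, T.pos_rotate _ _ _ hz⟩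
    obtain ⟨w, hw⟩ := hd.symm_of_interior h.interior
    have hwx : x ≠ w := by
      rintro rfl
      exact pos_asymm (T.pos_rotate _ _ _ hz) hw
    have hzx := pos_ne₃ hz
    refine ⟨{y, z, w}, ?_, fun hs => ?_, himg w⟩
    · rw [Finset.insert_comm]
      exact T.pos_triangle _ _ _ hw
    · have := hs (show x ∈ _ by simp)
      grind
  · have hd : T.IsDart z y := ⟨_, pos_rotate' hz⟩
    obtain ⟨w, hw⟩ := hd.symm_of_interior' h.interior
    have hwx : x ≠ w := by
      rintro rfl
      exact pos_asymm (pos_rotate' hz) hw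
    have hzx := pos_ne₂ hz
    refine ⟨{y, z, w}, T.pos_triangle _ _ _ hw, fun hs => ?_, himg w⟩
    have := hs (show x ∈ _ by simp)
    grind

theorem pure_contractCx (h : T.IsContractible x y) {s : Finset {u : V // u ≠ y}}
    (hs : s ∈ (T.contractCx hxy).faces) : ∃ t ∈ triangles (T.contractCx hxy), s ⊆ t := by
  obtain ⟨s', hs', rfl⟩ := mem_contractCx.1 hs
  obtain ⟨t, ht, hst⟩ := T.isDisk.pure _ hs'
  obtain ⟨t', ht', hn, hsub⟩ := h.exists_triangle_of_subset hxy ht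
  exact ⟨_, (mem_triangles_contractCx hxy).2 ⟨t', ht', hn, rfl⟩,
    (Finset.image_subset_image hst).trans hsub⟩

theorem oneSkeleton_adj_contractMap {a b : V} (hab : (oneSkeleton T.cx).Adj a b)
    (hne : contractMap hxy a ≠ contractMap hxy b) :
    (oneSkeleton (T.contractCx hxy)).Adj (contractMap hxy a) (contractMap hxy b) :=
  ⟨hne, pair_mem_contractCx hxy hab.2⟩

theorem connected_contractCx : (oneSkeleton (T.contractCx hxy)).Connected := by
  have hreach : ∀ a b : V, (oneSkeleton (T.contractCx hxy)).Reachable (contractMap hxy a)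
      (contractMap hxy b) := by
    intro a b
    refine connected_induction (T := T) (P := fun b => (oneSkeleton (T.contractCx hxy)).Reachable
      (contractMap hxy a) (contractMap hxy b)) (SimpleGraph.Reachable.refl _) ?_ b
    intro c d hcd hc
    by_cases he : contractMap hxy c = contractMap hxy d
    · exact he ▸ hc
    · exact hc.trans (oneSkeleton_adj_contractMap hxy hcd he).reachable
  have : Nonempty {u : V // u ≠ y} := ⟨⟨x, hxy⟩⟩
  refine ⟨fun a b => ?_⟩
  rw [← contractMap_coe hxy a, ← contractMap_coe hxy b]
  exact hreach _ _

theorem linkGraph_contractCx_of_ne {v : {u : V // u ≠ y}} (hv : v.1 ≠ x) :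
    (linkGraph (T.contractCx hxy) v).Connected := by
  have hlift : ∀ c, contractMap hxy c = v → c = v.1 := by
    intro c hc
    rw [← contractMap_coe hxy v, contractMap_eq_iff] at hc
    rcases hc with h | ⟨-, h⟩ | ⟨-, h⟩
    · exact h
    · exact absurd h v.2
    · exact absurd h hv
  have hadj : ∀ c, (oneSkeleton T.cx).Adj v.1 c →
      (oneSkeleton (T.contractCx hxy)).Adj v (contractMap hxy c) := by
    intro c hc
    have := oneSkeleton_adj_contractMap hxy hc
      (by rw [contractMap_coe]; exact fun e => hc.1 (hlift c e.symm).symm)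
    rwa [contractMap_coe] at this
  obtain ⟨a₀, h₀⟩ := T.exists_adj v.1
  refine linkGraph_connected (hadj a₀ h₀) fun b hb => ?_
  obtain ⟨c, d, hf, hc, rfl⟩ := exists_lift_pair hxy hb.2
  rw [hlift c hc] at hf
  have hvd : (oneSkeleton T.cx).Adj v.1 d :=
    ⟨fun e => hb.1 (by rw [← e, contractMap_coe]), hf⟩
  refine link_induction (T := T) (P := fun d => LinkReach (T.contractCx hxy) v
    (contractMap hxy a₀) (contractMap hxy d)) h₀ (.refl (hadj a₀ h₀)) ?_ hvd
  intro b c hbc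
  have hface := triple_mem_contractCx hxy (mem_triangles.1 (T.pos_triangle _ _ _ hbc)).1
  rw [contractMap_coe] at hface
  exact ⟨fun h => h.step (hadj c (pos_adj₃ hbc)) hface,
    fun h => h.step (hadj b (pos_adj hbc)) (by rwa [Finset.pair_comm])⟩

/-- The link of `y` is a cycle, so it stays connected when `x` is removed. The link of `x` is joined
to it at the common neighbours of `x` and `y`, and a passage through `y` can be replaced by a path
in the link of `y`. -/
theorem linkGraph_contractCx_self (h : T.IsContractible x y) :
    (linkGraph (T.contractCx hxy) ⟨x, hxy⟩).Connected := by
  have hx := contractMap_left hxy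
  have hy := contractMap_right hxy
  have hadj : ∀ p c, contractMap hxy p = ⟨x, hxy⟩ → c ≠ x → c ≠ y → (oneSkeleton T.cx).Adj p c →
      (oneSkeleton (T.contractCx hxy)).Adj ⟨x, hxy⟩ (contractMap hxy c) := by
    intro p c hp hcx hcy hc
    have := oneSkeleton_adj_contractMap hxy hc (by
      rw [hp, ← hx, Ne, contractMap_eq_iff]
      tauto)
    rwa [hp] at this
  have hface : ∀ p c d, contractMap hxy p = ⟨x, hxy⟩ → T.pos p c d →
      {⟨x, hxy⟩, contractMap hxy c, contractMap hxy d} ∈ (T.contractCx hxy).faces := by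
    intro p c d hp hcd
    have := triple_mem_contractCx hxy (mem_triangles.1 (T.pos_triangle _ _ _ hcd)).1
    rwa [hp] at this
  obtain ⟨z, hz⟩ := h.dart'
  have hzx : z ≠ x := (pos_ne₂ hz).symm
  have hzy : z ≠ y := pos_ne₃ hz
  have hbase := hadj y z hy hzx hzy (pos_adj₃ hz)
  have hreachy : ∀ c, (oneSkeleton T.cx).Adj y c → c = x ∨
      LinkReach (T.contractCx hxy) ⟨x, hxy⟩ (contractMap hxy z) (contractMap hxy c) := by
    intro c hc
    refine cyclic_link_induction (P := fun c => c = x ∨ LinkReach (T.contractCx hxy) ⟨x, hxy⟩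
      (contractMap hxy z) (contractMap hxy c)) h.interior (pos_adj hz) (Or.inl rfl) ?_ hc
    intro c d hcd hP
    by_cases hdx : d = x
    · exact Or.inl hdx
    right
    rcases hP with rfl | hP
    · rw [T.pos_coherent _ _ _ _ hcd hz]
      exact .refl hbase
    · exact hP.step (hadj y d hy hdx (pos_ne₃ hcd) (pos_adj₃ hcd)) (hface y c d hy hcd)
  have hreachx : ∀ c, (oneSkeleton T.cx).Adj x c → c = y ∨
      LinkReach (T.contractCx hxy) ⟨x, hxy⟩ (contractMap hxy z) (contractMap hxy c) := by
    intro c hc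
    refine link_induction (P := fun c => c = y ∨ LinkReach (T.contractCx hxy) ⟨x, hxy⟩
      (contractMap hxy z) (contractMap hxy c)) h.dart.adj (Or.inl rfl) ?_ hc
    intro c d hcd
    have hcx := (pos_ne hcd).symm
    have hdx := pos_ne₃ hcd
    by_cases hcy : c = y
    · subst hcy
      refine ⟨fun _ => Or.inr ?_, fun _ => Or.inl rfl⟩
      exact (hreachy d (pos_adj (T.pos_rotate _ _ _ hcd))).resolve_left hdx
    by_cases hdy : d = y
    · subst hdy
      refine ⟨fun _ => Or.inl rfl, fun _ => Or.inr ?_⟩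
      exact (hreachy c (pos_adj (T.pos_rotate _ _ _ hcd)).symm).resolve_left hcx
    have hf := hface x c d hx hcd
    constructor
    · rintro (h1 | h1)
      · exact absurd h1 hcy
      · exact Or.inr (h1.step (hadj x d hx hdx hdy (pos_adj₃ hcd)) hf)
    · rintro (h1 | h1)
      · exact absurd h1 hdy
      · exact Or.inr (h1.step (hadj x c hx hcx hcy (pos_adj hcd)) (by rwa [Finset.pair_comm]))
  refine linkGraph_connected hbase fun b hb => ?_
  obtain ⟨c, d, hf, hc, rfl⟩ := exists_lift_pair hxy hb.2
  have hd : ¬ (d = x ∨ d = y) := by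
    rintro (rfl | rfl)
    · exact hb.1 hx.symm
    · exact hb.1 hy.symm
  push Not at hd
  rw [← hx, contractMap_eq_iff] at hc
  rcases hc with rfl | ⟨-, e⟩ | ⟨rfl, -⟩
  · exact (hreachx d ⟨hd.1.symm, hf⟩).resolve_left hd.2
  · exact absurd e hxy
  · exact (hreachy d ⟨hd.2.symm, hf⟩).resolve_left hd.1

theorem card_trianglesAt_contractCx (h : T.IsContractible x y) {a b : {u : V // u ≠ y}}
    (hab : a ≠ b) : open Classical in (trianglesAt (T.contractCx hxy) {a, b}).card =
      (if ∃ c, T.contractPos hxy a b c then 1 else 0) +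
        (if ∃ c, T.contractPos hxy b a c then 1 else 0) :=
  card_trianglesAt_of_orientation (contractPos_triangle hxy) (h.contractPos_xor hxy)
    (h.contractPos_coherent hxy) hab

theorem isBoundaryEdge_contractCx (h : T.IsContractible x y) (e : Finset {u : V // u ≠ y}) :
    IsBoundaryEdge (T.contractCx hxy) e ↔
      ∃ i, e = {contractMap hxy (T.corner i), contractMap hxy (T.corner (i + 1))} := by
  constructor
  · rintro ⟨he, hc⟩
    obtain ⟨a, b, hab, rfl⟩ := Finset.card_eq_two.1 he.2
    rw [h.card_trianglesAt_contractCx hxy hab] at hc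
    by_cases h1 : ∃ c, T.contractPos hxy a b c <;> by_cases h2 : ∃ c, T.contractPos hxy b a c
    · simp only [h1, h2, if_true] at hc
      omega
    · obtain ⟨i, rfl, rfl⟩ := exists_corner_of_contractPos hxy h1 h2
      exact ⟨i, rfl⟩
    · obtain ⟨i, rfl, rfl⟩ := exists_corner_of_contractPos hxy h2 h1
      exact ⟨i, Finset.pair_comm _ _⟩
    · simp only [h1, h2, if_false] at hc
      omega
  · rintro ⟨i, rfl⟩
    have hadj := (isDart_corner (T := T) i).adj
    have hne : contractMap hxy (T.corner i) ≠ contractMap hxy (T.corner (i + 1)) := by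
      rw [Ne, contractMap_eq_iff]
      rintro (h1 | ⟨-, h1⟩ | ⟨h1, -⟩)
      · exact hadj.1 h1
      · exact h.interior _ h1.symm
      · exact h.interior _ h1.symm
    refine ⟨⟨pair_mem_contractCx hxy hadj.2, Finset.card_pair hne⟩, ?_⟩
    rw [h.card_trianglesAt_contractCx hxy hne, if_pos (h.exists_contractPos_corner hxy i),
      if_neg (h.not_exists_contractPos_corner hxy i)]

theorem isDisk_contractCx (h : T.IsContractible x y) : IsDisk (T.contractCx hxy) where
  card_le s hs := by
    obtain ⟨s', hs', rfl⟩ := mem_contractCx.1 hs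
    exact Finset.card_image_le.trans (T.isDisk.card_le s' hs')
  pure s hs := h.pure_contractCx hxy hs
  edge_card_le e he := by
    obtain ⟨a, b, hab, rfl⟩ := Finset.card_eq_two.1 he.2
    rw [h.card_trianglesAt_contractCx hxy hab]
    split_ifs <;> omega
  link_connected v := by
    by_cases hv : v.1 = x
    · have : v = ⟨x, hxy⟩ := Subtype.ext hv
      exact this ▸ h.linkGraph_contractCx_self hxy
    · exact linkGraph_contractCx_of_ne hxy hv
  connected := connected_contractCx hxy
  simply_connected v l hl := by
    -- A loop is homotopic to the image of a loop of `T`; the latter is null-homotopic, and its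
    -- homotopy is carried down by the contraction.
    obtain ⟨m, hm, hhom⟩ := h.exists_lift_path hxy l v.1 v.1 (by rwa [contractMap_coe])
    rw [contractMap_coe] at hhom
    refine (hhom.symm).trans _ _ _ ?_
    have := map_homotopy hxy (T.isDisk.simply_connected v.1 m hm)
    simpa [contractMap_coe] using this
  boundary_nonempty := ⟨_, (h.isBoundaryEdge_contractCx hxy _).2 ⟨0, rfl⟩⟩

/-- The triangulation obtained by contracting an edge. -/
def contract (h : T.IsContractible x y) : Triangulation {u : V // u ≠ y} where
  toAbstractSimplicialComplex := T.contractCx hxy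
  isDisk := h.isDisk_contractCx hxy
  pos := T.contractPos hxy
  pos_triangle := contractPos_triangle hxy
  pos_rotate := contractPos_rotate hxy
  pos_xor := h.contractPos_xor hxy
  pos_coherent := h.contractPos_coherent hxy
  corner i := contractMap hxy (T.corner i)
  corner_injective i j hij := by
    rcases (contractMap_eq_iff hxy).1 hij with h1 | ⟨-, h1⟩ | ⟨h1, -⟩
    · exact T.corner_injective h1
    · exact absurd h1.symm (h.interior _)
    · exact absurd h1.symm (h.interior _)
  boundary_iff := h.isBoundaryEdge_contractCx hxy
  corner_pos := h.exists_contractPos_corner hxy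

end IsContractible

end Triangulation

/-! ### Drawings under contraction -/

namespace Drawing

open Triangulation

variable {V : Type u} [Fintype V] [DecidableEq V] {T : Triangulation V} {x y : V}

/-- The drawing induced on the triangulation obtained by contracting an elastic edge. -/
def contract (ρ : Drawing T) (hxy : x ≠ y) (h : T.IsContractible x y) :
    Drawing (h.contract hxy) where
  toFun v := ρ.toFun v.1
  parallelogram := by
    have hc : ∀ i, ((h.contract hxy).corner i).1 = T.corner i := fun i => by
      change (contractMap hxy (T.corner i)).1 = _
      rw [contractMap_val, if_neg (h.interior i).symm]
    simpa only [hc] using ρ.parallelogram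

theorem contract_toFun (ρ : Drawing T) (hxy : x ≠ y) (h : T.IsContractible x y)
    (he : ρ.toFun x = ρ.toFun y) (v : V) :
    (ρ.contract hxy h).toFun (contractMap hxy v) = ρ.toFun v := by
  change ρ.toFun (contractMap hxy v).1 = _
  rw [contractMap_val]
  split_ifs with hv
  · rw [hv, he]
  · rfl

theorem mem_nondegenerate_iff {ρ : Drawing T} {t : Finset V} : t ∈ ρ.nondegenerate ↔
    t ∈ triangles T.cx ∧ ¬ Collinear ℂ (ρ.toFun '' (t : Set V)) := by
  classical
  exact Finset.mem_filter

theorem not_subset_of_nondegenerate {ρ : Drawing T} (hxy : x ≠ y) (he : ρ.toFun x = ρ.toFun y)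
    {t : Finset V} (ht : t ∈ ρ.nondegenerate) : ¬ {x, y} ⊆ t := by
  intro hs
  obtain ⟨z, -, rfl⟩ := exists_pos_of_pair (ρ.nondegenerate_subset ht) hxy (hs (by simp))
    (hs (by simp))
  refine (mem_nondegenerate.1 ht).2 (triArea_eq_zero_iff.2 ?_)
  rw [he, sub_self, zero_cross]

/-- Contracting an elastic edge does not change the nondegenerate triangles. -/
theorem sameNondegenerate_contract (ρ : Drawing T) (hxy : x ≠ y) (h : T.IsContractible x y)
    (he : ρ.toFun x = ρ.toFun y) : ρ.SameNondegenerate (ρ.contract hxy h) := by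
  have himg : ∀ t : Finset V, (ρ.contract hxy h).toFun ''
      ((t.image (contractMap hxy) : Finset _) : Set _) = ρ.toFun '' (t : Set V) := by
    intro t
    rw [Finset.coe_image, Set.image_image]
    exact Set.image_congr fun v _ => contract_toFun ρ hxy h he v
  refine ⟨contractMap hxy, ⟨?_, ?_, ?_⟩, fun t _ v _ => contract_toFun ρ hxy h he v, ?_⟩
  · intro t ht
    have hn := not_subset_of_nondegenerate hxy he ht
    rw [Finset.mem_coe, mem_nondegenerate_iff] at ht ⊢
    refine ⟨(mem_triangles_contractCx hxy).2 ⟨t, ht.1, hn, rfl⟩, ?_⟩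
    rw [himg]
    exact ht.2
  · intro t ht t' ht' htt
    exact h.canContract.image_injOn hxy (ρ.nondegenerate_subset ht) (ρ.nondegenerate_subset ht')
      (not_subset_of_nondegenerate hxy he ht) (not_subset_of_nondegenerate hxy he ht') htt
  · intro t' ht'
    rw [Finset.mem_coe, mem_nondegenerate_iff] at ht'
    obtain ⟨t, ht, -, rfl⟩ := (mem_triangles_contractCx hxy).1 ht'.1
    refine ⟨t, Finset.mem_coe.2 (mem_nondegenerate_iff.2 ⟨ht, ?_⟩), rfl⟩
    rw [← himg]
    exact ht'.2
  · intro a b c hp ht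
    exact contractPos_of_pos hxy hp (not_subset_of_nondegenerate hxy he ht)

end Drawing

/-! ### Reduction to simple drawings -/

namespace Drawing

open Triangulation

variable {V : Type u} [Fintype V] [DecidableEq V] {T : Triangulation V} {ρ : Drawing T}

theorem SameNondegenerate.trans {V' V'' : Type u} [Fintype V'] [DecidableEq V'] [Fintype V'']
    [DecidableEq V''] {T' : Triangulation V'} {T'' : Triangulation V''} {ρ' : Drawing T'}
    {ρ'' : Drawing T''} (h : ρ.SameNondegenerate ρ') (h' : ρ'.SameNondegenerate ρ'') :
    ρ.SameNondegenerate ρ'' := by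
  obtain ⟨f, h1, h2, h3⟩ := h
  obtain ⟨g, k1, k2, k3⟩ := h'
  refine ⟨g ∘ f, ?_, ?_, ?_⟩
  · have := k1.comp h1
    simpa only [Function.comp_def, Finset.image_image] using this
  · intro t ht v hv
    rw [Function.comp_apply, k2 _ (h1.mapsTo ht) _ (Finset.mem_image_of_mem f hv), h2 t ht v hv]
  · intro a b c hp ht
    refine k3 _ _ _ (h3 a b c hp ht) ?_
    have := h1.mapsTo ht
    simpa [Finset.image_insert] using this

theorem sameNondegenerate_of_eqOn {ρ' : Drawing T} (h : ρ'.nondegenerate = ρ.nondegenerate)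
    (h' : ∀ t ∈ ρ.nondegenerate, ∀ v ∈ t, ρ'.toFun v = ρ.toFun v) :
    ρ.SameNondegenerate ρ' := by
  refine ⟨id, ?_, h', fun _ _ _ hp _ => hp⟩
  simp only [Finset.image_id, h]
  exact Set.bijOn_id _

section Transfer

variable {V' : Type u} [Fintype V'] [DecidableEq V'] {T' : Triangulation V'} {ρ' : Drawing T'}

theorem SameNondegenerate.nonempty (h : ρ.SameNondegenerate ρ') (hne : ρ.nondegenerate.Nonempty) :
    ρ'.nondegenerate.Nonempty := by
  obtain ⟨f, h1, -, -⟩ := h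
  obtain ⟨t, ht⟩ := hne
  exact ⟨_, h1.mapsTo ht⟩

/-- Matched triangles have equal signed areas, because positions and orientations agree. So the
hypothesis survives every reduction. -/
theorem SameNondegenerate.noZeroSum (h : ρ.SameNondegenerate ρ') (hρ : ρ.NoZeroSum) :
    ρ'.NoZeroSum := by
  obtain ⟨f, h1, h2, h3⟩ := h
  intro S' hS' hne
  have harea : ∀ t ∈ ρ.nondegenerate, ρ'.area (t.image f) = ρ.area t := by
    intro t ht
    obtain ⟨a, b, c, hp, rfl⟩ := exists_pos (ρ.nondegenerate_subset ht)
    have himg : ({a, b, c} : Finset V).image f = {f a, f b, f c} := by simp [Finset.image_insert]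
    rw [himg, area_eq ρ hp, area_eq ρ' (h3 _ _ _ hp ht), h2 _ ht a (by simp),
      h2 _ ht b (by simp), h2 _ ht c (by simp)]
  let S := ρ.nondegenerate.filter fun t => t.image f ∈ S'
  have hS : S.image (fun t => t.image f) = S' := by
    ext t'
    simp only [S, Finset.mem_image, Finset.mem_filter]
    constructor
    · rintro ⟨t, ⟨-, ht⟩, rfl⟩
      exact ht
    · intro ht'
      obtain ⟨t, ht, rfl⟩ := h1.surjOn (hS' ht')
      exact ⟨t, ⟨ht, ht'⟩, rfl⟩
  have hSn : S ⊆ ρ.nondegenerate := Finset.filter_subset _ _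
  have hsum : ∑ t ∈ S', ρ'.area t = ∑ t ∈ S, ρ.area t := by
    rw [← hS, Finset.sum_image fun t ht t' ht' e => h1.injOn (hSn ht) (hSn ht') e]
    exact Finset.sum_congr rfl fun t ht => harea t (hSn ht)
  rw [hsum]
  refine hρ S hSn ?_
  rw [← hS] at hne
  exact Finset.image_nonempty.1 hne

end Transfer

/-- There is a drawing with the same nondegenerate triangles and fewer vertices. -/
def IsReducible (ρ : Drawing T) : Prop :=
  ∃ (V' : Type u) (_ : Fintype V') (_ : DecidableEq V') (T' : Triangulation V') (ρ' : Drawing T'),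
    Fintype.card V' < Fintype.card V ∧ ρ.SameNondegenerate ρ'

theorem IsReducible.of_same {ρ' : Drawing T} (h : ρ.SameNondegenerate ρ')
    (h' : ρ'.IsReducible) : ρ.IsReducible := by
  obtain ⟨V', i1, i2, T', ρ'', hc, hs⟩ := h'
  exact ⟨V', i1, i2, T', ρ'', hc, h.trans hs⟩

theorem isReducible_of_isContractible {x y : V} (h : T.IsContractible x y)
    (he : ρ.toFun x = ρ.toFun y) : ρ.IsReducible := by
  have hxy := h.dart.adj.1
  exact ⟨_, inferInstance, inferInstance, _, ρ.contract hxy h,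
    Fintype.card_subtype_lt (p := fun u => u ≠ y) (x := y) (by simp),
    ρ.sameNondegenerate_contract hxy h he⟩

end Drawing

/-- `CanContract` renames `y` as `x` and is not visibly symmetric. The criterion that every common
neighbour spans a triangle with the edge is symmetric. This is used to choose which end survives. -/
theorem Triangulation.CanContract.symm {V : Type u} [Fintype V] [DecidableEq V]
    {T : Triangulation V} {x y : V} (h : T.CanContract x y) (hxy : (oneSkeleton T.cx).Adj x y) :
    T.CanContract y x := by
  by_contra hn
  obtain ⟨z, hc, hE, ht⟩ := exists_subdivision hxy.symm hn
  have hz : ∀ u v w : V, ({u, v, w} : Finset V).card = 3 → w ≠ u ∧ w ≠ v := by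
    intro u v w h3
    have h4 := Finset.card_le_two (a := u) (b := v)
    constructor
    · rintro rfl
      rw [Finset.pair_comm v w, Finset.insert_idem] at h3
      omega
    · rintro rfl
      rw [Finset.pair_eq_singleton] at h3
      omega
  obtain ⟨n1, n2⟩ := hz _ _ _ hc
  refine ht ?_
  rw [Finset.insert_comm]
  exact h.triangle hxy (isEdge_adj (hE _ (by grind) (Finset.card_pair n2.symm)))
    (isEdge_adj (hE _ (by grind) (Finset.card_pair n1.symm)))

namespace Drawing

open Triangulation

variable {V : Type u} [Fintype V] [DecidableEq V] {T : Triangulation V} {ρ : Drawing T}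

/-- The removed end must not be a corner, so the edge is contracted towards its corner if it has
one. It cannot join two corners: adjacent ones span a boundary edge, and opposite ones drawn at one
point would flatten the parallelogram. -/
theorem NoZeroSum.isReducible_of_elastic (hρ : ρ.NoZeroSum) (hne : ρ.nondegenerate.Nonempty)
    {x y : V} (hE : IsInteriorEdge T.cx {x, y}) (he : ρ.toFun x = ρ.toFun y)
    (hc : T.CanContract x y) : ρ.IsReducible := by
  obtain ⟨h1, h2⟩ := isInteriorEdge_iff.1 hE
  by_cases hy : ∀ i, y ≠ T.corner i
  · exact isReducible_of_isContractible ⟨h1, h2, hy, hc⟩ he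
  by_cases hx : ∀ i, x ≠ T.corner i
  · exact isReducible_of_isContractible ⟨h2, h1, hx, hc.symm h1.adj⟩ he.symm
  exfalso
  push Not at hx hy
  obtain ⟨i, rfl⟩ := hx
  obtain ⟨j, rfl⟩ := hy
  have hij : j = i ∨ j = i + 1 ∨ i = j + 1 ∨ j = i + 2 := by
    clear * -
    revert i j
    decide
  rcases hij with rfl | rfl | rfl | rfl
  · exact h1.adj.1 rfl
  · exact not_isDart_corner _ h2
  · exact not_isDart_corner _ h1
  · have hpar : ρ.toFun (T.corner (i + 3)) - ρ.toFun (T.corner i) =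
        -(ρ.toFun (T.corner (i + 1)) - ρ.toFun (T.corner i)) := by
      have hp := ρ.parallelogram
      have h3 : ρ.toFun (T.corner i) + ρ.toFun (T.corner (i + 2)) =
          ρ.toFun (T.corner (i + 1)) + ρ.toFun (T.corner (i + 3)) := by
        clear * - hp
        fin_cases i
        · exact hp
        · change ρ.toFun (T.corner 1) + ρ.toFun (T.corner 3) =
            ρ.toFun (T.corner 2) + ρ.toFun (T.corner 0)
          rw [← hp, add_comm]
        · change ρ.toFun (T.corner 2) + ρ.toFun (T.corner 0) =
            ρ.toFun (T.corner 3) + ρ.toFun (T.corner 1)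
          rw [add_comm, hp, add_comm]
        · change ρ.toFun (T.corner 3) + ρ.toFun (T.corner 1) =
            ρ.toFun (T.corner 0) + ρ.toFun (T.corner 2)
          rw [hp, add_comm]
      rw [← he] at h3
      have h4 : ρ.toFun (T.corner (i + 3)) =
          ρ.toFun (T.corner i) + ρ.toFun (T.corner i) - ρ.toFun (T.corner (i + 1)) := by
        rw [h3]; abel
      rw [h4]; abel
    refine hρ.cross_corner_ne_zero_all hne i ?_
    rw [hpar]
    simp only [cross, Pi.neg_apply]
    ring

/-- An interior vertex of degenerate triangles only can be moved to a neighbour. -/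
theorem exists_redraw (ρ : Drawing T) {v : V} (hv : ∀ i, v ≠ T.corner i)
    (hdeg : ∀ t ∈ ρ.nondegenerate, v ∉ t) :
    ∃ ρ' : Drawing T, ρ.SameNondegenerate ρ' ∧
      ∃ w, (oneSkeleton T.cx).Adj v w ∧ ρ'.toFun v = ρ'.toFun w := by
  by_cases hel : ∃ w, (oneSkeleton T.cx).Adj v w ∧ ρ.toFun v = ρ.toFun w
  · exact ⟨ρ, sameNondegenerate_of_eqOn rfl fun _ _ _ _ => rfl, hel⟩
  push Not at hel
  obtain ⟨w, hw⟩ := T.exists_adj v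
  have hcross : ∀ a b, T.pos v a b →
      cross (ρ.toFun a - ρ.toFun v) (ρ.toFun b - ρ.toFun v) = 0 := by
    intro a b hp
    by_contra h
    exact hdeg {v, a, b} (mem_nondegenerate.2 ⟨T.pos_triangle _ _ _ hp, fun h' =>
      h (triArea_eq_zero_iff.1 h')⟩) (by simp)
  -- Consecutive neighbours are on a line through `v`, and no neighbour is drawn at `v`, so all of
  -- them are on one line. Moving `v` along this line to `w` keeps its triangles degenerate.
  have hline : ∀ a, (oneSkeleton T.cx).Adj v a →
      cross (ρ.toFun w - ρ.toFun v) (ρ.toFun a - ρ.toFun v) = 0 := by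
    intro a ha
    refine link_induction (P := fun a =>
      cross (ρ.toFun w - ρ.toFun v) (ρ.toFun a - ρ.toFun v) = 0) hw (cross_self _) ?_ ha
    intro a b hp
    have h0 := hcross a b hp
    have ha := sub_ne_zero.2 (hel a (pos_adj hp)).symm
    have hb := sub_ne_zero.2 (hel b (pos_adj₃ hp)).symm
    exact ⟨fun h => cross_eq_zero_trans ha (cross_eq_zero_symm h) h0,
      fun h => cross_eq_zero_trans hb (cross_eq_zero_symm h) (cross_eq_zero_symm h0)⟩
  let ρ' : Drawing T := ⟨Function.update ρ.toFun v (ρ.toFun w), by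
    simpa [Function.update_of_ne (hv _).symm] using ρ.parallelogram⟩
  have hv' : ρ'.toFun v = ρ.toFun w := Function.update_self _ _ _
  have hu : ∀ u, u ≠ v → ρ'.toFun u = ρ.toFun u := fun u h => Function.update_of_ne h _ _
  have hnd : ρ'.nondegenerate = ρ.nondegenerate := by
    ext t
    by_cases hvt : v ∈ t
    · refine ⟨fun ht => ?_, fun ht => absurd hvt (hdeg t ht)⟩
      exfalso
      obtain ⟨a, b, hp, rfl⟩ := exists_pos_of_mem (ρ'.nondegenerate_subset ht) hvt
      refine (mem_nondegenerate.1 ht).2 (triArea_eq_zero_iff.2 ?_)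
      rw [hv', hu a (pos_ne hp).symm, hu b (pos_ne₃ hp)]
      have h1 := hline a (pos_adj hp)
      have h2 := hline b (pos_adj₃ hp)
      have h3 := hcross a b hp
      simp only [cross, Pi.sub_apply] at h1 h2 h3 ⊢
      linear_combination h3 - h2 + h1
    · have himg : ρ'.toFun '' (t : Set V) = ρ.toFun '' (t : Set V) :=
        Set.image_congr fun u hut => hu u fun e => hvt (e ▸ hut)
      rw [mem_nondegenerate_iff, mem_nondegenerate_iff, himg]
  refine ⟨ρ', sameNondegenerate_of_eqOn hnd ?_, w, hw, by rw [hv', hu w hw.1.symm]⟩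
  intro t ht u hut
  exact hu u fun e => hdeg t ht (e ▸ hut)

/-- A drawing is reducible if some 3-cycle contains no nondegenerate triangle. -/
theorem NoZeroSum.isReducible_of_subdivision (hρ : ρ.NoZeroSum) (hne : ρ.nondegenerate.Nonempty)
    {S : Finset V} (hS : T.IsSubdivision S) (hin : ∀ t ∈ ρ.nondegenerate, ¬ T.IsInside S t) :
    ρ.IsReducible := by
  obtain ⟨n, hn⟩ : ∃ n, n = {t | T.IsInside S t}.ncard := ⟨_, rfl⟩
  induction n using Nat.strong_induction_on generalizing S with
  | _ n ih =>
    obtain ⟨t, ht⟩ := exists_isInside hS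
    -- The three vertices of `S` do not span a triangle, so an inside triangle has a vertex off `S`;
    -- all triangles at this vertex are inside `S`, hence degenerate.
    obtain ⟨v, hvt, hvS⟩ : ∃ v ∈ t, v ∉ S := by
      by_contra hno
      push Not at hno
      have := Finset.eq_of_subset_of_card_le (s := t) (t := S) hno
        (by rw [hS.1, (mem_triangles.1 ht.1).2])
      exact hS.2.2 (this ▸ ht.1)
    have hv := interior_of_isInside hvS ht hvt
    obtain ⟨ρ', hsame, w, hw, he⟩ := ρ.exists_redraw hv fun s hs hvs =>
      hin s hs (isInside_star hvS ht hvt (ρ.nondegenerate_subset hs) hvs)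
    have hd := isDart_of_interior hw hv
    have hE : IsInteriorEdge T.cx {v, w} := isInteriorEdge_iff.2 ⟨hd, hd.symm_of_interior hv⟩
    by_cases hc : T.CanContract v w
    · exact .of_same hsame ((hsame.noZeroSum hρ).isReducible_of_elastic (hsame.nonempty hne) hE he hc)
    obtain ⟨z, hz⟩ := exists_subdivision hw hc
    have hvz : (oneSkeleton T.cx).Adj v z := by
      have hcard := hz.1
      have hne : v ≠ z := by
        rintro rfl
        rw [Finset.pair_comm w v, Finset.insert_idem] at hcard
        have := Finset.card_le_two (a := v) (b := w)
        omega
      exact isEdge_adj (hz.2.1 _ (by grind) (Finset.card_pair hne))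
    have hsub : ∀ s, T.IsInside {v, w, z} s → T.IsInside S s := fun s hs =>
      isInside_of_isInside hvS ht hvt hw hvz hs
    refine ih _ ?_ hz (fun s hs h => hin s hs (hsub s h)) rfl
    rw [hn]
    -- The inclusion is strict: some triangle at the edge `vw` is not inside the new 3-cycle, but as
    -- a triangle at `v` it is inside `S`.
    refine Set.ncard_lt_ncard (Set.ssubset_iff_subset_ne.2 ⟨hsub, fun heq => ?_⟩) (Set.toFinite _)
    obtain ⟨s, hs, hes, hout⟩ := exists_not_isInside hz hE (by grind)
    refine hout ?_
    have : s ∈ {t | T.IsInside S t} := isInside_star hvS ht hvt hs (hes (by simp))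
    rw [← heq] at this
    exact this

/-- Each condition of simplicity, when it fails, allows a reduction. For an interior vertex of
degenerate triangles, moving it onto a neighbour leads back to one of the other two conditions. -/
theorem NoZeroSum.isSimple_or_isReducible (hρ : ρ.NoZeroSum) (hne : ρ.nondegenerate.Nonempty) :
    ρ.IsSimple ∨ ρ.IsReducible := by
  by_contra hcon
  push Not at hcon
  obtain ⟨hns, hred⟩ := hcon
  refine hns ⟨fun S hS => ?_, ?_, fun v hv => ?_⟩
  · by_contra hno
    push Not at hno
    exact hred (hρ.isReducible_of_subdivision hne hS hno)
  · rintro ⟨v, w, hE, he, hc⟩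
    exact hred (hρ.isReducible_of_elastic hne hE he hc)
  · by_contra hno
    push Not at hno
    have hv := mem_interiorVertices.1 hv
    obtain ⟨ρ', hsame, w, hw, he⟩ := ρ.exists_redraw hv hno
    have hρ' := hsame.noZeroSum hρ
    have hne' := hsame.nonempty hne
    refine hred (.of_same hsame ?_)
    have hd := isDart_of_interior hw hv
    by_cases hc : T.CanContract v w
    · exact hρ'.isReducible_of_elastic hne'
        (isInteriorEdge_iff.2 ⟨hd, hd.symm_of_interior hv⟩) he hc
    · obtain ⟨z, hz⟩ := exists_subdivision hw hc
      exact hρ'.isReducible_of_subdivision hne' hz fun t ht => hρ'.not_isInside he ht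

theorem exists_isSimple (n : ℕ) : ∀ (V : Type u) [Fintype V] [DecidableEq V] (T : Triangulation V)
    (ρ : Drawing T), Fintype.card V = n → ρ.nondegenerate.Nonempty → ρ.NoZeroSum →
    ∃ (V' : Type u) (_ : Fintype V') (_ : DecidableEq V') (T' : Triangulation V')
      (ρ' : Drawing T'), ρ'.IsSimple ∧ ρ.SameNondegenerate ρ' := by
  induction n using Nat.strong_induction_on with
  | _ n ih =>
    intro V _ _ T ρ hn hne hρ
    rcases hρ.isSimple_or_isReducible hne with hs | ⟨V₁, i1, i2, T₁, ρ₁, hlt, hsame⟩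
    · exact ⟨V, _, _, T, ρ, hs, sameNondegenerate_of_eqOn rfl fun _ _ _ _ => rfl⟩
    · obtain ⟨V', j1, j2, T', ρ', hs, hsame'⟩ := ih _ (hn ▸ hlt) V₁ T₁ ρ₁ rfl
        (hsame.nonempty hne) (hsame.noZeroSum hρ)
      exact ⟨V', j1, j2, T', ρ', hs, hsame.trans hsame'⟩

end Drawing

end SquareDrawing

theorem mainTheorem8 :
    (∀ (V : Type u) [Fintype V] [DecidableEq V] (T : SquareDrawing.Triangulation V)
      (ρ : SquareDrawing.Drawing T),
      0 < ρ.nondegenerate.card → ρ.NoZeroSum →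
      ∃ (V' : Type u) (_ : Fintype V') (_ : DecidableEq V') (T' : SquareDrawing.Triangulation V')
        (ρ' : SquareDrawing.Drawing T'), ρ'.IsSimple ∧ ρ.SameNondegenerate ρ') ∧
    (∀ (V : Type u) [Fintype V] [DecidableEq V] (T : SquareDrawing.Triangulation V)
      (ρ : SquareDrawing.Drawing T) (l : ℕ),
      ρ.IsSimple → ρ.nondegenerate.card = l → 0 < l → ρ.NoZeroSum →
      (T.interiorVertices.card : ℚ) ≤ 3 / 2 * (l : ℚ) - 2 ∧
      ((SquareDrawing.triangles T.cx).card : ℚ) ≤ 3 * (l : ℚ) - 2) := by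
  refine ⟨fun V _ _ T ρ hl hρ => ?_, ?_⟩
  · exact SquareDrawing.Drawing.exists_isSimple _ V T ρ rfl (Finset.card_pos.1 hl) hρ
  · rintro V _ _ T ρ l hs rfl hl hρ
    have h1 := hs.card_le hρ (Finset.card_pos.1 hl)
    have h2 := T.card_triangles
    have h1' : (2 * T.interiorVertices.card + 4 : ℚ) ≤ 3 * ρ.nondegenerate.card := by
      exact_mod_cast h1
    have h2' : ((SquareDrawing.triangles T.cx).card : ℚ) = 2 * T.interiorVertices.card + 2 := by
      exact_mod_cast h2
    constructor <;> linarith
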